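/- **Setting.** Let $d\ge 2$ (for instance $d=2,3$), $r\ge 1$, $C_{\mathsf{SR}}>0$. Let $\mathcal T_h$ be a conforming mesh of finitely many closed $d$-simplices of maximal diameter $h$ triangulating a polygonal/polyhedral domain $\Omega\subset\mathbb R^d$ (i.e. $\Omega$ is the interior of the union of the elements), and shape regular: every $T\in\mathcal T_h$ contains a ball of diameter $C_{\mathsf{SR}}\operatorname{diam}T$. Let $A:\Omega\to\mathbb R^{d\times d}$ be measurable and symmetric and $n:\Omega\to\mathbb R$ measurable, with $|\xi|^2\le A(x)\xi\cdot\xi\le a_{\max}|\xi|^2$ for all $\xi\in\mathbb R^d$ and $0<n_{\min}\le n(x)\le 1$ for a.e. $x\in\Omega$ (where $a_{\max}\ge1\ge n_{\min}$). Let $k>0$, and let $V^h\subset H^1_0(\Omega)$ be the space of continuous functions that are polynomials of degree $\le r$ on each element and vanish on $\partial\Omega$, with nodal basis $\{\phi_l\}$ indexed by the Lagrange nodes $l$ in $\Omega$. Assume that for some $C_{\mathsf{inv}}\ge 1$ $$\|\nabla v\|_{L^2(T)}\le C_{\mathsf{inv}}\,k\,\|v\|_{L^2(T)}\qquad\text{for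 all }T\in\mathcal T_h,\ v\in V^h .$$ Let $\Omega=\bigcup_{i=1}^N\Omega_i^c$ be a cover by open sets, each the interior of a union of elements. Let $\Lambda_c$ be the maximal number of indices $i$ for which $\overline{\Omega_i^c}$ contains a given element, let $\mathrm{dof}(\Omega_i^c)$ be the set of nodes $l\in\Omega$ with $\operatorname{supp}\phi_l\subseteq\overline{\Omega_i^c}$, and let $\mu_l=\#\{i: l\in\mathrm{dof}(\Omega_i^c)\}$. On $\widetilde V_i=\{v|_{\Omega_i^c}:v\in V^h\}$ define $\Xi_i v=\sum_{l\in\mathrm{dof}(\Omega_i^c)}\mu_l^{-1}v(l)\,\phi_l|_{\Omega_i^c}$ and $$b_i(u,v)=\int_{\Omega_i^c}\bigl(A\nabla u\cdot\nabla v-k^2nuv\bigr)\,dx,\qquad c_i(w,v)=\int_{\Omega_i^c}\bigl(A\nabla\,\Xi_iw\cdot\nabla\,\Xi_iv+k^2n\,\Xi_iw\,\Xi_iv\bigr)\,dx .$$ Consider the local generalised eigenvalue problem: find $\lambda\in\mathbb R$ and $p\in\widetilde V_i\setminus\{0\}$ with $b_i(p,v)=\lambda\,c_i(p,v)$ for all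 $v\in\widetilde V_i$. Let $\ker c_i=\{v\in\widetilde V_i:c_i(v,w)=0\ \forall w\in\widetilde V_i\}$. For $L\in\mathbb N$, say that $\Omega_i^c$ is *not thin with constant $L$* if every element in $\overline{\Omega_i^c}$ can be joined, by a chain of at most $L+1$ elements in $\overline{\Omega_i^c}$ in which consecutive ones share an edge, to an element having a Lagrange node that belongs to $\mathrm{dof}(\Omega_i^c)$ or lies on $\partial\Omega$. **Theorem (estimate of $\lambda_1^i$ from below).** There is a constant $C>0$ depending only on $d,r,C_{\mathsf{SR}}$, and for every $L$ a constant $C_1>0$ depending only on $d,r,C_{\mathsf{SR}},L$, such that in every setting as above with $(hk)^2\le C_1$, and for every $i\in\{1,\dots,N\}$ for which $\Omega_i^c$ is not thin with constant $L$: 1. $b_i(v,v)\ge C_1h^{-2}\|v\|_{L^2(\Omega_i^c)}^2$ for all $v\in\ker c_i$; 2. if $c_i\ne0$, the generalised eigenvalue problem has a smallest eigenvalue $\lambda_1^i$, and $$\lambda_1^i\ \ge\ -\,C\,C_{\mathrm{eig}},\qquad C_{\mathrm{eig}}=\Lambda_c^2\,n_{\min}^{-1}\,\bigl(a_{\max}C_{\mathsf{inv}}^2+2\bigr)^2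 .$$ -/

import Mathlib

open MeasureTheory

noncomputable section

namespace HkGenEO

/-- The closed simplex spanned by a finite set of vertices. -/
def hull {d : ℕ} (T : Finset (EuclideanSpace ℝ (Fin d))) : Set (EuclideanSpace ℝ (Fin d)) :=
  convexHull ℝ (T : Set (EuclideanSpace ℝ (Fin d)))

/-- The open polyhedral set composed of the simplices in `S`. -/
def region {d : ℕ} (S : Finset (Finset (EuclideanSpace ℝ (Fin d)))) :
    Set (EuclideanSpace ℝ (Fin d)) :=
  interior (⋃ T ∈ S, hull T)

/-- A conforming simplicial mesh in `ℝ^d`.  An element is given by its `d + 1` affinely independent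
vertices, and two elements meet in the simplex spanned by their common vertices. -/
structure Mesh (d : ℕ) where
  elems : Finset (Finset (EuclideanSpace ℝ (Fin d)))
  elems_nonempty : elems.Nonempty
  card_eq : ∀ T ∈ elems, T.card = d + 1
  affineIndependent : ∀ T ∈ elems,
    AffineIndependent ℝ (fun p : T => (p : EuclideanSpace ℝ (Fin d)))
  conforming : ∀ T ∈ elems, ∀ T' ∈ elems,
    hull T ∩ hull T' ⊆ convexHull ℝ ((T : Set (EuclideanSpace ℝ (Fin d))) ∩ T')

namespace Mesh

variable {d : ℕ} (M : Mesh d)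

/-- The polyhedral domain `Ω` that is triangulated by the mesh. -/
def Ω : Set (EuclideanSpace ℝ (Fin d)) := region M.elems

/-- The maximal element diameter `h`. -/
def h : ℝ := M.elems.sup' M.elems_nonempty (fun T => Metric.diam (hull T))

/-- Shape regularity `ρ_T ≥ C h_T`: every element `T` of diameter `h_T` contains a ball of
diameter `C h_T`. -/
def ShapeRegular (C : ℝ) : Prop :=
  ∀ T ∈ M.elems, ∃ x, Metric.closedBall x (C * Metric.diam (hull T) / 2) ⊆ hull T

/-- The `H¹₀(Ω)`-conforming Lagrange finite element space `V^h` of degree `r`: continuous functions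
which are polynomials of degree at most `r` on every element and vanish on `∂Ω`
(they are extended by zero outside `Ω`). -/
def Vh (r : ℕ) : Submodule ℝ (EuclideanSpace ℝ (Fin d) → ℝ) where
  carrier := {v | Continuous v ∧ (∀ x ∉ M.Ω, v x = 0) ∧
    ∀ T ∈ M.elems, ∃ q : MvPolynomial (Fin d) ℝ, q.totalDegree ≤ r ∧
      ∀ x ∈ hull T, v x = MvPolynomial.eval (fun j => x j) q}
  zero_mem' := ⟨continuous_const, fun _ _ => rfl, fun _ _ => ⟨0, by simp, by simp⟩⟩
  add_mem' := by
    rintro v w ⟨hv, hv0, hvp⟩ ⟨hw, hw0, hwp⟩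
    refine ⟨hv.add hw, fun x hx => by simp [hv0 x hx, hw0 x hx], fun T hT => ?_⟩
    obtain ⟨p, hp, hp'⟩ := hvp T hT
    obtain ⟨q, hq, hq'⟩ := hwp T hT
    exact ⟨p + q, (MvPolynomial.totalDegree_add p q).trans (max_le hp hq),
      fun x hx => by simp [hp' x hx, hq' x hx]⟩
  smul_mem' := by
    rintro c v ⟨hv, hv0, hvp⟩
    refine ⟨hv.const_smul c, fun x hx => by simp [hv0 x hx], fun T hT => ?_⟩
    obtain ⟨p, hp, hp'⟩ := hvp T hT
    exact ⟨c • p, (MvPolynomial.totalDegree_smul_le c p).trans hp,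
      fun x hx => by simp [hp' x hx]⟩

end Mesh

/-- The Lagrange nodes of degree `r` of the simplex `T`: the points whose barycentric coordinates
are nonnegative integer multiples of `1 / r`. -/
def nodes {d : ℕ} (r : ℕ) (T : Finset (EuclideanSpace ℝ (Fin d))) :
    Set (EuclideanSpace ℝ (Fin d)) :=
  {x | ∃ α : EuclideanSpace ℝ (Fin d) → ℕ, ∑ p ∈ T, α p = r ∧
    x = ∑ p ∈ T, ((α p : ℝ) / (r : ℝ)) • p}

namespace Mesh

variable {d : ℕ} (M : Mesh d) (r : ℕ)

/-- The degrees of freedom of `V^h`, identified with the Lagrange nodes of the mesh in `Ω`. -/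
def freedoms : Set (EuclideanSpace ℝ (Fin d)) :=
  {x | x ∈ M.Ω ∧ ∃ T ∈ M.elems, x ∈ nodes r T}

/-- `φ` is the element of `V^h` with value `1` at the node `l` and `0` at all other nodes. -/
def IsNodal (l : EuclideanSpace ℝ (Fin d)) (φ : EuclideanSpace ℝ (Fin d) → ℝ) : Prop :=
  φ ∈ M.Vh r ∧ φ l = 1 ∧ ∀ y ∈ M.freedoms r, y ≠ l → φ y = 0

open Classical in
/-- The nodal basis function `φ_l` of `V^h`; for every `l ∈ M.freedoms r` there is exactly one
function as in `IsNodal`. -/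
def basisFun (l : EuclideanSpace ℝ (Fin d)) : EuclideanSpace ℝ (Fin d) → ℝ :=
  if hl : ∃ φ, M.IsNodal r l φ then hl.choose else 0

/-- The interior degrees of freedom `dof(Ω')` of the set `Ω'` composed of the elements in `S`:
those `l` with `supp φ_l ⊆ closure Ω'`. -/
def dof (S : Finset (Finset (EuclideanSpace ℝ (Fin d)))) : Set (EuclideanSpace ℝ (Fin d)) :=
  {l | l ∈ M.freedoms r ∧ tsupport (M.basisFun r l) ⊆ closure (region S)}

/-- The space of restrictions to `Ω'` of functions of `V^h`.  A function on `Ω'` is represented by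
its extension by zero; all integrals below are over the open set `Ω'`. -/
def Vtilde (S : Finset (Finset (EuclideanSpace ℝ (Fin d)))) :
    Submodule ℝ (EuclideanSpace ℝ (Fin d) → ℝ) where
  carrier := {w | ∃ v ∈ M.Vh r, w = (region S).indicator v}
  zero_mem' := ⟨0, (M.Vh r).zero_mem, by simp⟩
  add_mem' := by
    rintro _ _ ⟨v, hv, rfl⟩ ⟨w, hw, rfl⟩
    exact ⟨v + w, (M.Vh r).add_mem hv hw, (Set.indicator_add' _ v w).symm⟩
  smul_mem' := by
    rintro c _ ⟨v, hv, rfl⟩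
    exact ⟨c • v, (M.Vh r).smul_mem c hv, (Set.indicator_const_smul _ c v).symm⟩

variable {N : ℕ} (S : Fin N → Finset (Finset (EuclideanSpace ℝ (Fin d))))

/-- `Λ_c`: the maximal number of subdomains that contain a given element. -/
def overlap : ℕ := M.elems.sup (fun T => {i | T ∈ S i}.ncard)

/-- `μ_l`: the number of subdomains for which `l` is an interior degree of freedom. -/
def mult (l : EuclideanSpace ℝ (Fin d)) : ℕ := {i | l ∈ M.dof r (S i)}.ncard

/-- The partition of unity operator `Ξ_i`,
`Ξ_i v = ∑_{l ∈ dof(Ω_i)} μ_l⁻¹ v_l φ_l|_{Ω_i}`; the coefficient `v_l` of `v` is its value at the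
node `l`. -/
def Xi (i : Fin N) (v : EuclideanSpace ℝ (Fin d) → ℝ) : EuclideanSpace ℝ (Fin d) → ℝ :=
  fun x => ∑ᶠ l ∈ M.dof r (S i),
    ((M.mult r S l : ℝ)⁻¹ * v l) * (region (S i)).indicator (M.basisFun r l) x

end Mesh

/-- The `L²(ω)` norm. -/
def l2norm {d : ℕ} (ω : Set (EuclideanSpace ℝ (Fin d))) (v : EuclideanSpace ℝ (Fin d) → ℝ) : ℝ :=
  Real.sqrt (∫ x in ω, v x ^ 2)

/-- The `L²(ω)` norm of the gradient.  For a continuous piecewise polynomial the classical gradient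
exists almost everywhere and is the weak gradient. -/
def l2normGrad {d : ℕ} (ω : Set (EuclideanSpace ℝ (Fin d)))
    (v : EuclideanSpace ℝ (Fin d) → ℝ) : ℝ :=
  Real.sqrt (∫ x in ω, ‖gradient v x‖ ^ 2)

/-- `a_ω(u, v) = ∫_ω A ∇u · ∇v`. -/
def formA {d : ℕ} (A : EuclideanSpace ℝ (Fin d) → Matrix (Fin d) (Fin d) ℝ)
    (ω : Set (EuclideanSpace ℝ (Fin d))) (u v : EuclideanSpace ℝ (Fin d) → ℝ) : ℝ :=
  ∫ x in ω, inner ℝ (Matrix.toEuclideanLin (A x) (gradient u x)) (gradient v x)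

/-- `(u, v)_{n, ω} = ∫_ω n u v`. -/
def formN {d : ℕ} (n : EuclideanSpace ℝ (Fin d) → ℝ)
    (ω : Set (EuclideanSpace ℝ (Fin d))) (u v : EuclideanSpace ℝ (Fin d) → ℝ) : ℝ :=
  ∫ x in ω, n x * u x * v x

/-- `b_ω(u, v) = a_ω(u, v) - k² (u, v)_{n, ω}`. -/
def formB {d : ℕ} (A : EuclideanSpace ℝ (Fin d) → Matrix (Fin d) (Fin d) ℝ)
    (n : EuclideanSpace ℝ (Fin d) → ℝ) (k : ℝ)
    (ω : Set (EuclideanSpace ℝ (Fin d))) (u v : EuclideanSpace ℝ (Fin d) → ℝ) : ℝ :=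
  formA A ω u v - k ^ 2 * formN n ω u v

/-- `(u, v)_{1, k, ω} = a_ω(u, v) + k² (u, v)_{n, ω}`. -/
def inner1k {d : ℕ} (A : EuclideanSpace ℝ (Fin d) → Matrix (Fin d) (Fin d) ℝ)
    (n : EuclideanSpace ℝ (Fin d) → ℝ) (k : ℝ)
    (ω : Set (EuclideanSpace ℝ (Fin d))) (u v : EuclideanSpace ℝ (Fin d) → ℝ) : ℝ :=
  formA A ω u v + k ^ 2 * formN n ω u v

/-- The assumptions on the coefficients in `Ω`: measurability, symmetry of `A`,
`|ξ|² ≤ A ξ · ξ ≤ a_max |ξ|²` and `n_min ≤ n ≤ 1` almost everywhere in `Ω`. -/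
structure Coefficients {d : ℕ} (Ω : Set (EuclideanSpace ℝ (Fin d)))
    (A : EuclideanSpace ℝ (Fin d) → Matrix (Fin d) (Fin d) ℝ)
    (n : EuclideanSpace ℝ (Fin d) → ℝ) (amax nmin : ℝ) : Prop where
  one_le_amax : 1 ≤ amax
  nmin_pos : 0 < nmin
  nmin_le_one : nmin ≤ 1
  measurable_A : ∀ i j, AEMeasurable (fun x => A x i j) (volume.restrict Ω)
  measurable_n : AEMeasurable n (volume.restrict Ω)
  symm_A : ∀ᵐ x ∂volume.restrict Ω, (A x).IsSymm
  bounds_A : ∀ᵐ x ∂volume.restrict Ω, ∀ ξ : EuclideanSpace ℝ (Fin d),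
    ‖ξ‖ ^ 2 ≤ inner ℝ (Matrix.toEuclideanLin (A x) ξ) ξ ∧
      inner ℝ (Matrix.toEuclideanLin (A x) ξ) ξ ≤ amax * ‖ξ‖ ^ 2
  bounds_n : ∀ᵐ x ∂volume.restrict Ω, nmin ≤ n x ∧ n x ≤ 1

namespace Mesh

variable {d : ℕ} (M : Mesh d) (r : ℕ)

/-- The inverse estimates `‖∇v‖_T ≤ C_inv k ‖v‖_T` for all elements `T` and all `v ∈ V^h`. -/
def InverseEstimate (k Cinv : ℝ) : Prop :=
  ∀ T ∈ M.elems, ∀ v ∈ M.Vh r, l2normGrad (hull T) v ≤ Cinv * k * l2norm (hull T) v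

/-- The union of the elements in `S` is nowhere thinner than a bounded number of elements: every
element of `S` is joined, by a chain of at most `L + 1` elements of `S` in which consecutive ones
share an edge, to an element that has a Lagrange node which is an interior degree of freedom of the
union or lies on `∂Ω`. -/
def NotThin (S : Finset (Finset (EuclideanSpace ℝ (Fin d)))) (L : ℕ) : Prop :=
  ∀ T ∈ S, ∃ m ≤ L, ∃ c : ℕ → Finset (EuclideanSpace ℝ (Fin d)),
    c 0 = T ∧ (∀ j ≤ m, c j ∈ S) ∧
    (∀ j < m, 2 ≤ ((c j : Set (EuclideanSpace ℝ (Fin d))) ∩ c (j + 1)).ncard) ∧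
    ∃ y ∈ nodes r (c m), y ∈ M.dof r S ∨ y ∈ frontier M.Ω

variable (A : EuclideanSpace ℝ (Fin d) → Matrix (Fin d) (Fin d) ℝ)
  (n : EuclideanSpace ℝ (Fin d) → ℝ) (k : ℝ)
  {N : ℕ} (S : Fin N → Finset (Finset (EuclideanSpace ℝ (Fin d)))) (i : Fin N)

/-- The local form `b_i` of the subdomain `Ω_i`. -/
def localB (u v : EuclideanSpace ℝ (Fin d) → ℝ) : ℝ := formB A n k (region (S i)) u v

/-- The local form `c_i(w, v) = (Ξ_i w, Ξ_i v)_{1, k, Ω_i}`. -/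
def localC (w v : EuclideanSpace ℝ (Fin d) → ℝ) : ℝ :=
  inner1k A n k (region (S i)) (M.Xi r S i w) (M.Xi r S i v)

/-- The kernel of `c_i` in the local finite element space. -/
def kerC : Set (EuclideanSpace ℝ (Fin d) → ℝ) :=
  {v | v ∈ M.Vtilde r (S i) ∧ ∀ w ∈ M.Vtilde r (S i), M.localC r A n k S i v w = 0}

/-- The (finite) eigenvalues of the local generalised eigenvalue problem
`b_i(p, v) = λ c_i(p, v)` for all `v`, with `p ≠ 0`. -/
def eigenvalues : Set ℝ :=
  {lam | ∃ p ∈ M.Vtilde r (S i), p ≠ 0 ∧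
    ∀ v ∈ M.Vtilde r (S i), localB A n k S i p v = lam * M.localC r A n k S i p v}

/-- `C_eig = Λ_c² n_min⁻¹ (a_max C_inv² + 2)²`. -/
def Ceig (amax nmin Cinv : ℝ) : ℝ :=
  (M.overlap S : ℝ) ^ 2 * nmin⁻¹ * (amax * Cinv ^ 2 + 2) ^ 2

end Mesh

end HkGenEO

end

namespace HkGenEO

/-! ### Generalised eigenvalue problems for pairs of bilinear forms -/

section Eigenvalues

variable {W : Type*} [AddCommGroup W] [Module ℝ W]

/-! On the local space write a and m for the forms with weights A and n, b = a - k²m and e = a +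
k²m, so that c is e pulled back along the partition of unity operator Ξ.

The first point is a Poincaré inequality. A function that vanishes at all interior degrees of
freedom has, by non-thinness, a zero within a bounded number of elements of every element: at an
interior node, or on ∂Ω where all of V^h vanishes. Adding up oscillations along the chain bounds its
L² norm by h times that of its gradient (`exists_integral_sq_le_integral_gradient_sq`). For hk small
the term k²m is therefore absorbed by a, and b is coercive on such functions, with e ≤ 2b
(`exists_coercivity`). A function in the kernel of c satisfies Ξv = 0, hence vanishes at these
nodes, which gives the first claim.

For the second claim split p = w + z, where w interpolates p at the interior nodes and is zero at
the others. Then z vanishes at the interior nodes, so b(z,z) ≥ e(z,z)/2, and Young's inequality for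
the cross term yields b(p,p) ≥ -3e(w,w). The inverse estimate bounds e(w,w) by k²‖w‖². The functions
w and Ξp have nodal values that differ only by the multiplicities, which lie between 1 and the
overlap, so elementwise norm equivalence (`exists_integral_nodalSum_sq_le`) bounds ‖w‖ by ‖Ξp‖, and
k²‖Ξp‖² is controlled by c(p,p). Thus b + 3κ C_eig c is positive semidefinite.

Finally, a finite-dimensional variational argument (`exists_isLeast_eigenvalue`) turns this bound
into one for the smallest eigenvalue, although c may be degenerate; coercivity of b on its kernel
excludes kernel eigenvectors. -/

theorem bilin_sum_sum_le {ι : Type*} (s : Finset ι) (C : LinearMap.BilinForm ℝ W)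
    (hC : ∀ v, 0 ≤ C v v) (x : ι → W) :
    C (∑ i ∈ s, x i) (∑ i ∈ s, x i) ≤ s.card * ∑ i ∈ s, C (x i) (x i) := by
  have key : ∀ i j, C (x i) (x j) + C (x j) (x i) ≤ C (x i) (x i) + C (x j) (x j) := by
    intro i j
    have := hC (x i - x j)
    simp only [map_sub, LinearMap.sub_apply] at this
    linarith
  have e1 : C (∑ i ∈ s, x i) (∑ i ∈ s, x i) = ∑ i ∈ s, ∑ j ∈ s, C (x i) (x j) := by
    simp only [map_sum, LinearMap.sum_apply]
    rw [Finset.sum_comm]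
  have e2 : 2 * C (∑ i ∈ s, x i) (∑ i ∈ s, x i)
      = ∑ i ∈ s, ∑ j ∈ s, (C (x i) (x j) + C (x j) (x i)) := by
    simp only [Finset.sum_add_distrib]
    rw [Finset.sum_comm (f := fun i j => C (x j) (x i)), ← e1]
    ring
  have e3 : ∑ i ∈ s, ∑ j ∈ s, (C (x i) (x i) + C (x j) (x j))
      = 2 * (s.card * ∑ i ∈ s, C (x i) (x i)) := by
    simp only [Finset.sum_add_distrib, Finset.sum_const, nsmul_eq_mul, ← Finset.mul_sum]
    ring
  have := Finset.sum_le_sum fun i (_ : i ∈ s) => Finset.sum_le_sum fun j (_ : j ∈ s) => key i j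
  linarith

theorem exists_form_le_mul_of_posDef [FiniteDimensional ℝ W] (Q C : LinearMap.BilinForm ℝ W)
    (hQs : ∀ u v, Q u v = Q v u) (hQ : ∀ v, v ≠ 0 → 0 < Q v v) (hC : ∀ v, 0 ≤ C v v) :
    ∃ K, 0 < K ∧ ∀ v, C v v ≤ K * Q v v := by
  classical
  obtain ⟨b, hb⟩ := LinearMap.BilinForm.exists_orthogonal_basis (B := Q) ⟨fun u v => hQs u v⟩
  have hq : ∀ i, 0 < Q (b i) (b i) := fun i => hQ _ (b.ne_zero i)
  set K' : ℝ := ∑ i, C (b i) (b i) / Q (b i) (b i)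
  have hK' : ∀ i, C (b i) (b i) ≤ K' * Q (b i) (b i) := by
    intro i
    have : C (b i) (b i) / Q (b i) (b i) ≤ K' :=
      Finset.single_le_sum (f := fun i => C (b i) (b i) / Q (b i) (b i))
        (fun j _ => div_nonneg (hC _) (hq j).le) (Finset.mem_univ i)
    rwa [div_le_iff₀ (hq i)] at this
  have hK0 : 0 ≤ K' := Finset.sum_nonneg fun j _ => div_nonneg (hC _) (hq j).le
  -- The dimension is the loss in `bilin_sum_sum_le`; the `+ 1` keeps the constant positive when `W`
  -- or `C` is trivial.
  refine ⟨Module.finrank ℝ W * K' + 1, by positivity, fun v => ?_⟩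
  have hv : v = ∑ i, b.repr v i • b i := (b.sum_repr v).symm
  have h1 := bilin_sum_sum_le Finset.univ C hC (fun i => b.repr v i • b i)
  rw [← hv] at h1
  have h2 : Q v v = ∑ i, b.repr v i ^ 2 * Q (b i) (b i) := by
    conv_lhs => rw [hv]
    simp only [map_sum, LinearMap.sum_apply, map_smul, LinearMap.smul_apply, smul_eq_mul]
    refine Finset.sum_congr rfl fun i _ => ?_
    rw [Finset.sum_eq_single i]
    · ring
    · intro j _ hj
      have : Q (b j) (b i) = 0 := hb hj
      rw [this]; simp
    · simp
  have h3 : ∑ i, C (b.repr v i • b i) (b.repr v i • b i) ≤ K' * Q v v := by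
    rw [h2, Finset.mul_sum]
    refine Finset.sum_le_sum fun i _ => ?_
    simp only [map_smul, LinearMap.smul_apply, smul_eq_mul]
    have := mul_le_mul_of_nonneg_left (hK' i) (sq_nonneg (b.repr v i))
    nlinarith
  have h4 : 0 ≤ Q v v := by
    by_cases h : v = 0
    · simp [h]
    · exact (hQ v h).le
  rw [Finset.card_univ, Fintype.card_fin] at h1
  have h6 := mul_le_mul_of_nonneg_left h3 (Nat.cast_nonneg (α := ℝ) (Module.finrank ℝ W))
  nlinarith

theorem form_apply_eq_zero_of_self_eq_zero (C : LinearMap.BilinForm ℝ W)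
    (hCs : ∀ u v, C u v = C v u) (hC : ∀ v, 0 ≤ C v v) {v : W} (hv : C v v = 0) (w : W) :
    C v w = 0 := by
  by_contra h
  -- Along `w - t • v` the quadratic form is affine in `t`; this `t` gives it the value `-1`.
  have h1 := hC (w - ((C w w + 1) / (2 * C v w)) • v)
  have h2 := hC (w - (-(C w w + 1) / (2 * C v w)) • v)
  simp only [map_sub, LinearMap.sub_apply, map_smul, LinearMap.smul_apply, smul_eq_mul, hv,
    hCs w v] at h1
  have e : (C w w + 1) / (2 * C v w) * C v w = (C w w + 1) / 2 := by field_simp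
  rw [e] at h1
  linarith

/-- The least eigenvalue is the supremum of all `t` for which `B - t • C` is positive semidefinite.
At the supremum the difference has a null vector, which is an eigenvector: were it definite, it
would dominate a positive multiple of `C` and `t` could be increased. An eigenvector cannot satisfy
`C p p = 0`, since `B p p` would be both zero and positive; so every eigenvalue is a Rayleigh
quotient. -/
theorem exists_isLeast_eigenvalue [FiniteDimensional ℝ W] (B C : LinearMap.BilinForm ℝ W)
    (hBs : ∀ u v, B u v = B v u) (hCs : ∀ u v, C u v = C v u) (hC : ∀ v, 0 ≤ C v v)
    (hker : ∀ v, v ≠ 0 → C v v = 0 → 0 < B v v) (hne : ∃ v w, C v w ≠ 0)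
    {m : ℝ} (hm : ∀ v, m * C v v ≤ B v v) :
    ∃ lam, IsLeast {lam : ℝ | ∃ p, p ≠ 0 ∧ ∀ v, B p v = lam * C p v} lam ∧ m ≤ lam := by
  obtain ⟨v₀, w₀, hvw⟩ := hne
  have hv₀ : 0 < C v₀ v₀ := lt_of_le_of_ne (hC _) fun h =>
    hvw (form_apply_eq_zero_of_self_eq_zero C hCs hC h.symm w₀)
  set T : Set ℝ := {t | ∀ v, t * C v v ≤ B v v}
  have hbdd : BddAbove T := ⟨B v₀ v₀ / C v₀ v₀, fun t ht => by
    rw [le_div_iff₀ hv₀]; exact ht v₀⟩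
  have hTne : T.Nonempty := ⟨m, hm⟩
  set lam := sSup T
  have hlam : ∀ v, lam * C v v ≤ B v v := by
    intro v
    rcases (hC v).eq_or_lt with h | h
    · have := hm v
      rw [← h] at this ⊢
      simpa using this
    · rw [← le_div_iff₀ h]
      exact csSup_le hTne fun t ht => by rw [le_div_iff₀ h]; exact ht v
  have hmlam : m ≤ lam := le_csSup hbdd hm
  refine ⟨lam, ⟨?_, ?_⟩, hmlam⟩
  · by_contra hcon
    set Q : LinearMap.BilinForm ℝ W := B - lam • C with hQdef
    have hQa : ∀ u v, Q u v = B u v - lam * C u v := fun u v => by simp [hQdef]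
    have hQs : ∀ u v, Q u v = Q v u := fun u v => by rw [hQa, hQa, hBs, hCs]
    have hQ0 : ∀ v, 0 ≤ Q v v := fun v => by rw [hQa]; linarith [hlam v]
    have hQp : ∀ v, v ≠ 0 → 0 < Q v v := by
      intro v hv
      refine lt_of_le_of_ne (hQ0 v) fun h => hcon ⟨v, hv, fun w => ?_⟩
      have := form_apply_eq_zero_of_self_eq_zero Q hQs hQ0 h.symm w
      rw [hQa] at this
      linarith
    obtain ⟨K, hK, hKC⟩ := exists_form_le_mul_of_posDef Q C hQs hQp hC
    have : lam + K⁻¹ ∈ T := fun v => by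
      have h1 := hKC v
      rw [hQa, ← inv_mul_le_iff₀ hK] at h1
      linarith
    have := le_csSup hbdd this
    have : 0 < K⁻¹ := inv_pos.2 hK
    linarith
  · rintro μ ⟨p, hp, hpe⟩
    have h1 := hpe p
    have h2 : 0 < C p p := by
      refine lt_of_le_of_ne (hC p) fun h => ?_
      have := hker p hp h.symm
      rw [h1, ← h] at this
      simp at this
    have := hlam p
    rw [h1] at this
    exact le_of_mul_le_mul_right this h2

end Eigenvalues

/-! ### Polynomials of bounded degree on convex bodies -/

/-- Interpolation at `r + 1` fixed points of `[0, 1]` writes `p` in a fixed Lagrange basis with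
coefficients at most `M`, so the Lipschitz constants of the basis polynomials at zero add up to a
constant depending on `r` only. -/
theorem exists_polynomial_lipschitz_at_zero (r : ℕ) :
    ∃ c : ℝ, 1 ≤ c ∧ ∀ p : Polynomial ℝ, p.natDegree ≤ r → ∀ M : ℝ,
      (∀ s ∈ Set.Icc (0 : ℝ) 1, |p.eval s| ≤ M) →
      ∀ s ∈ Set.Icc (0 : ℝ) 1, |p.eval s - p.eval 0| ≤ c * M * s := by
  classical
  set N := Finset.range (r + 1)
  set ν : ℕ → ℝ := fun j => (j : ℝ) / (r + 1)
  have hinj : Set.InjOn ν N := fun a _ b _ h => by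
    have h : (a : ℝ) / (r + 1) = b / (r + 1) := h
    have h0 : (r + 1 : ℝ) ≠ 0 := by positivity
    field_simp at h
    exact_mod_cast h
  have hν : ∀ j ∈ N, ν j ∈ Set.Icc (0 : ℝ) 1 := fun j hj => by
    refine ⟨by positivity, ?_⟩
    have : j < r + 1 := Finset.mem_range.1 hj
    have h' : (j : ℝ) ≤ r + 1 := by exact_mod_cast this.le
    exact div_le_one_of_le₀ h' (by positivity)
  have hlip : ∀ q : Polynomial ℝ, ∃ c : ℝ, 0 ≤ c ∧ ∀ s ∈ Set.Icc (0 : ℝ) 1,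
      |q.eval s - q.eval 0| ≤ c * s := by
    intro q
    obtain ⟨c, hc⟩ := (isCompact_Icc (a := (0 : ℝ)) (b := 1)).exists_bound_of_continuousOn
      (f := fun s => q.divX.eval s) q.divX.continuous.continuousOn
    refine ⟨max c 0, le_max_right _ _, fun s hs => ?_⟩
    have e : q.eval s - q.eval 0 = q.divX.eval s * s := by
      conv_lhs => rw [← q.divX_mul_X_add]
      simp
    rw [e, abs_mul, abs_of_nonneg hs.1]
    exact mul_le_mul_of_nonneg_right ((hc s hs).trans (le_max_left _ _)) hs.1
  choose c hc0 hc using fun j => hlip (Lagrange.basis N ν j)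
  refine ⟨∑ j ∈ N, c j + 1, by linarith [Finset.sum_nonneg fun j (_ : j ∈ N) => hc0 j], ?_⟩
  intro p hp M hM s hs
  have hM0 : 0 ≤ M := (abs_nonneg _).trans (hM 0 ⟨le_rfl, zero_le_one⟩)
  have hdeg : p.degree < N.card := by
    rw [Finset.card_range]
    exact (Polynomial.degree_le_natDegree).trans_lt (by exact_mod_cast Nat.lt_succ_of_le hp)
  have hpi := Lagrange.eq_interpolate_of_eval_eq (s := N) (v := ν) (fun j => p.eval (ν j)) hinj hdeg
    (fun _ _ => rfl)
  have he : ∀ t, p.eval t = ∑ j ∈ N, p.eval (ν j) * (Lagrange.basis N ν j).eval t := by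
    intro t
    conv_lhs => rw [hpi]
    simp [Lagrange.interpolate_apply, Polynomial.eval_finsetSum]
  have e : p.eval s - p.eval 0 = ∑ j ∈ N, p.eval (ν j) *
      ((Lagrange.basis N ν j).eval s - (Lagrange.basis N ν j).eval 0) := by
    rw [he s, he 0, ← Finset.sum_sub_distrib]
    exact Finset.sum_congr rfl fun j _ => by ring
  rw [e]
  calc _ ≤ ∑ j ∈ N, |p.eval (ν j) *
      ((Lagrange.basis N ν j).eval s - (Lagrange.basis N ν j).eval 0)| :=
        Finset.abs_sum_le_sum_abs _ _
    _ ≤ ∑ j ∈ N, M * (c j * s) := Finset.sum_le_sum fun j hj => by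
        rw [abs_mul]
        exact mul_le_mul (hM _ (hν j hj)) (hc j s hs) (abs_nonneg _) hM0
    _ = (∑ j ∈ N, c j) * M * s := by
        rw [← Finset.mul_sum, ← Finset.sum_mul]; ring
    _ ≤ _ := by
        have : 0 ≤ M * s := mul_nonneg hM0 hs.1
        nlinarith

/-- The function defined on `ℝ^d` by a polynomial in the coordinates. -/
noncomputable def polyFun {d : ℕ} (q : MvPolynomial (Fin d) ℝ) (x : EuclideanSpace ℝ (Fin d)) : ℝ :=
  MvPolynomial.eval (fun j => x j) q

theorem continuous_polyFun {d : ℕ} (q : MvPolynomial (Fin d) ℝ) : Continuous (polyFun q) := by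
  have : Continuous fun x : EuclideanSpace ℝ (Fin d) => (fun j => x j) := by fun_prop
  exact (MvPolynomial.continuous_eval q).comp this

theorem exists_polynomial_on_line {d r : ℕ} (q : MvPolynomial (Fin d) ℝ) (hq : q.totalDegree ≤ r)
    (x y : EuclideanSpace ℝ (Fin d)) :
    ∃ p : Polynomial ℝ, p.natDegree ≤ r ∧ ∀ s : ℝ, p.eval s = polyFun q (x + s • (y - x)) := by
  refine ⟨MvPolynomial.aeval
    (fun j => Polynomial.C (x j) + Polynomial.C (y j - x j) * Polynomial.X) q, ?_, fun s => ?_⟩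
  · have := MvPolynomial.aeval_natDegree_le (m := r) (n := 1) q hq
      (fun j => Polynomial.C (x j) + Polynomial.C (y j - x j) * Polynomial.X) (fun j => by
        rw [add_comm]; exact Polynomial.natDegree_linear_le)
    simpa using this
  · rw [polyFun, ← Polynomial.coe_evalRingHom, MvPolynomial.aeval_def, MvPolynomial.hom_eval₂,
      MvPolynomial.eval, MvPolynomial.coe_eval₂Hom]
    congr 1
    · ext a; simp
    · funext j; simp; ring

/-- Let `|q|` have its maximum `M` over `K` at `z`. Shrinking `K` towards `z` by the factor `ε = 1 /
(2c)` keeps `|q| ≥ M / 2`, by the one-dimensional estimate on segments from `z`, and the shrunken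
body fills the fraction `ε ^ d` of the volume. The constant is thus independent of the shape of `K`,
and no reference element is needed. -/
theorem exists_sq_mul_volume_le_integral_sq (d r : ℕ) :
    ∃ κ : ℝ, 0 < κ ∧ ∀ (K : Set (EuclideanSpace ℝ (Fin d))), IsCompact K → Convex ℝ K →
      ∀ q : MvPolynomial (Fin d) ℝ, q.totalDegree ≤ r → ∀ x ∈ K,
        polyFun q x ^ 2 * volume.real K ≤ κ * ∫ y in K, polyFun q y ^ 2 := by
  obtain ⟨c, hc1, hc⟩ := exists_polynomial_lipschitz_at_zero r
  set ε : ℝ := (2 * c)⁻¹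
  have hε : 0 < ε := by positivity
  have hε1 : ε ≤ 1 := inv_le_one_of_one_le₀ (by linarith)
  have hcε : c * ε = 1 / 2 := by simp only [ε]; field_simp
  refine ⟨4 * (ε ^ d)⁻¹, by positivity, fun K hK hKc q hq x hx => ?_⟩
  have hcont : Continuous fun y => |polyFun q y| := (continuous_polyFun q).abs
  obtain ⟨z, hz, hmax⟩ := hK.exists_isMaxOn ⟨x, hx⟩ hcont.continuousOn
  set M := |polyFun q z|
  have hM0 : 0 ≤ M := abs_nonneg _
  have hxM : |polyFun q x| ≤ M := hmax hx
  set K' := AffineMap.homothety z ε '' K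
  have hK'K : K' ⊆ K := by
    rintro _ ⟨y, hy, rfl⟩
    rw [AffineMap.homothety_apply, vsub_eq_sub, vadd_eq_add]
    have := hKc hz hy (by linarith : 0 ≤ 1 - ε) hε.le (by ring)
    convert this using 1
    module
  have hK'c : IsCompact K' := hK.image (AffineMap.homothety_continuous z ε)
  have hvol : volume.real K' = ε ^ d * volume.real K := by
    rw [Measure.real, Measure.addHaar_image_homothety, ENNReal.toReal_mul, ENNReal.toReal_ofReal
      (abs_nonneg _), finrank_euclideanSpace_fin, abs_of_nonneg (by positivity), Measure.real]
  have hlow : ∀ y ∈ K', (M / 2) ^ 2 ≤ polyFun q y ^ 2 := by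
    rintro _ ⟨y, hy, rfl⟩
    obtain ⟨p, hp, hpe⟩ := exists_polynomial_on_line q hq z y
    have h1 := hc p hp M (fun s hs => by
      rw [hpe]
      refine hmax ?_
      have := hKc hz hy (by linarith [hs.2] : 0 ≤ 1 - s) hs.1 (by ring)
      convert this using 1
      module) ε ⟨hε.le, hε1⟩
    rw [hpe, hpe, zero_smul, add_zero, mul_right_comm, hcε] at h1
    rw [AffineMap.homothety_apply, vsub_eq_sub, vadd_eq_add, add_comm]
    have h2 : M ≤ |polyFun q (z + ε • (y - z))| + 1 / 2 * M := by
      have := abs_sub_abs_le_abs_sub (polyFun q z) (polyFun q (z + ε • (y - z)))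
      rw [abs_sub_comm] at this
      linarith
    rw [← sq_abs (polyFun q _)]
    exact pow_le_pow_left₀ (by positivity) (by linarith) 2
  have hint : IntegrableOn (fun y => polyFun q y ^ 2) K volume :=
    ((continuous_polyFun q).pow 2).continuousOn.integrableOn_compact hK
  have h1 : (M / 2) ^ 2 * volume.real K' ≤ ∫ y in K', polyFun q y ^ 2 := by
    have := setIntegral_mono_on (μ := volume) (s := K') (f := fun _ => (M / 2) ^ 2)
      (integrableOn_const hK'c.measure_lt_top.ne) (hint.mono_set hK'K) hK'c.measurableSet hlow
    simpa [mul_comm] using this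
  have h2 : ∫ y in K', polyFun q y ^ 2 ≤ ∫ y in K, polyFun q y ^ 2 :=
    setIntegral_mono_set hint (Filter.Eventually.of_forall fun y => sq_nonneg _)
      hK'K.eventuallyLE
  rw [hvol] at h1
  have h3 : polyFun q x ^ 2 ≤ M ^ 2 := by
    rw [← sq_abs (polyFun q x)]; exact pow_le_pow_left₀ (abs_nonneg _) hxM 2
  have h4 : polyFun q x ^ 2 * volume.real K ≤ M ^ 2 * volume.real K :=
    mul_le_mul_of_nonneg_right h3 measureReal_nonneg
  have h5 : 4 * (ε ^ d)⁻¹ * ((M / 2) ^ 2 * (ε ^ d * volume.real K)) = M ^ 2 * volume.real K := by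
    field_simp; ring
  calc _ ≤ _ := h4
    _ = _ := h5.symm
    _ ≤ _ := mul_le_mul_of_nonneg_left (h1.trans h2) (by positivity)

theorem totalDegree_pderiv_le {σ : Type*} (j : σ) (q : MvPolynomial σ ℝ) :
    (MvPolynomial.pderiv j q).totalDegree ≤ q.totalDegree := by
  refine Finset.sup_le fun m hm => ?_
  rw [MvPolynomial.mem_support_iff, MvPolynomial.coeff_pderiv] at hm
  have h := MvPolynomial.le_totalDegree (MvPolynomial.mem_support_iff.2 (left_ne_zero_of_mul hm))
  refine le_trans ?_ h
  rw [Finsupp.sum_add_index' (fun _ => rfl) (fun _ _ _ => rfl)]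
  exact Nat.le_add_right _ _

theorem hasGradientAt_polyFun {d : ℕ} (q : MvPolynomial (Fin d) ℝ) (x : EuclideanSpace ℝ (Fin d)) :
    HasGradientAt (polyFun q)
      (WithLp.toLp 2 fun j => polyFun (MvPolynomial.pderiv j q) x) x := by
  rw [hasGradientAt_iff_hasFDerivAt]
  induction q using MvPolynomial.induction_on with
  | C a =>
    have hf : polyFun (d := d) (MvPolynomial.C a) = fun _ => a := by funext y; simp [polyFun]
    rw [hf]
    refine (hasFDerivAt_const a x).congr_fderiv ?_
    ext y
    simp [polyFun, PiLp.inner_apply]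
  | add p q hp hq =>
    have hf : polyFun (p + q) = polyFun p + polyFun q := by funext y; simp [polyFun]
    rw [hf]
    refine (hp.add hq).congr_fderiv ?_
    ext y
    simp [polyFun, PiLp.inner_apply, mul_add, Finset.sum_add_distrib]
  | mul_X p j hp =>
    have hX : HasFDerivAt (fun y : EuclideanSpace ℝ (Fin d) => y j)
        (EuclideanSpace.proj j : EuclideanSpace ℝ (Fin d) →L[ℝ] ℝ) x :=
      (EuclideanSpace.proj j : EuclideanSpace ℝ (Fin d) →L[ℝ] ℝ).hasFDerivAt
    have hf : polyFun (p * MvPolynomial.X j) = fun y => polyFun p y * y j := by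
      funext y; simp [polyFun]
    rw [hf]
    refine (hp.mul hX).congr_fderiv ?_
    ext y
    simp [polyFun, PiLp.inner_apply, MvPolynomial.pderiv_X, mul_add,
      Finset.sum_add_distrib, Pi.single_apply, Finset.mul_sum, apply_ite]
    ring_nf

/-- The previous sup bound, applied to each partial derivative, controls the gradient uniformly on
`K`; the mean value inequality on the convex set does the rest. -/
theorem exists_sq_sub_mul_volume_le_integral_gradient (d r : ℕ) :
    ∃ κ : ℝ, 0 < κ ∧ ∀ (K : Set (EuclideanSpace ℝ (Fin d))), IsCompact K → Convex ℝ K →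
      ∀ q : MvPolynomial (Fin d) ℝ, q.totalDegree ≤ r → ∀ x ∈ K, ∀ y ∈ K,
        (polyFun q x - polyFun q y) ^ 2 * volume.real K ≤
          κ * Metric.diam K ^ 2 * ∫ z in K, ‖gradient (polyFun q) z‖ ^ 2 := by
  obtain ⟨κ, hκ, h⟩ := exists_sq_mul_volume_le_integral_sq d r
  refine ⟨κ, hκ, fun K hK hKc q hq x hx y hy => ?_⟩
  set G := ∫ z in K, ‖gradient (polyFun q) z‖ ^ 2 with hG
  have hgrad : ∀ z, ‖gradient (polyFun q) z‖ ^ 2 = ∑ j, polyFun (MvPolynomial.pderiv j q) z ^ 2 := by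
    intro z
    rw [(hasGradientAt_polyFun q z).gradient, EuclideanSpace.norm_sq_eq]
    simp
  have hint : ∀ j, IntegrableOn (fun z => polyFun (MvPolynomial.pderiv j q) z ^ 2) K volume :=
    fun j => ((continuous_polyFun _).pow 2).continuousOn.integrableOn_compact hK
  have hsup : ∀ z ∈ K, ‖gradient (polyFun q) z‖ ^ 2 * volume.real K ≤ κ * G := by
    intro z hz
    rw [hG]
    simp only [hgrad]
    rw [integral_finsetSum _ fun j _ => hint j, Finset.mul_sum, Finset.sum_mul]
    exact Finset.sum_le_sum fun j _ =>
      h K hK hKc _ ((totalDegree_pderiv_le j q).trans hq) z hz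
  have hG0 : 0 ≤ G := integral_nonneg fun z => sq_nonneg _
  rcases (measureReal_nonneg (μ := volume) (s := K)).eq_or_lt with hv | hv
  · rw [← hv, mul_zero]; positivity
  set g := Real.sqrt (κ * G / volume.real K)
  have hbound : ∀ z ∈ K, ‖fderiv ℝ (polyFun q) z‖ ≤ g := by
    intro z hz
    rw [← toDual_gradient, LinearIsometryEquiv.norm_map]
    refine Real.le_sqrt_of_sq_le ?_
    rw [le_div_iff₀ hv]
    exact hsup z hz
  have hmv := hKc.norm_image_sub_le_of_norm_fderiv_le (𝕜 := ℝ) (f := polyFun q) (C := g)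
    (fun z _ => (hasGradientAt_polyFun q z).differentiableAt) hbound hy hx
  have hd : ‖x - y‖ ≤ Metric.diam K := by
    rw [← dist_eq_norm]; exact Metric.dist_le_diam_of_mem hK.isBounded hx hy
  have hg0 : 0 ≤ g := Real.sqrt_nonneg _
  have h1 : (polyFun q x - polyFun q y) ^ 2 ≤ g ^ 2 * Metric.diam K ^ 2 := by
    rw [← mul_pow, ← sq_abs, ← Real.norm_eq_abs]
    exact pow_le_pow_left₀ (norm_nonneg _) (hmv.trans (mul_le_mul_of_nonneg_left hd hg0)) 2
  have h2 : g ^ 2 * volume.real K = κ * G := by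
    rw [Real.sq_sqrt (by positivity)]; field_simp
  calc _ ≤ g ^ 2 * Metric.diam K ^ 2 * volume.real K := mul_le_mul_of_nonneg_right h1 hv.le
    _ = κ * Metric.diam K ^ 2 * G := by rw [mul_right_comm, h2]; ring

/-! ### Simplices and barycentric coordinates -/

abbrev Pt (d : ℕ) : Type := EuclideanSpace ℝ (Fin d)

/-- `T` is the vertex set of a nondegenerate simplex in `ℝ^d`. -/
def IsSimplex {d : ℕ} (T : Finset (Pt d)) : Prop :=
  T.card = d + 1 ∧ AffineIndependent ℝ (fun p : T => (p : Pt d))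

section Simplex

variable {d : ℕ} {T : Finset (Pt d)}

theorem Mesh.isSimplex (M : Mesh d) (hT : T ∈ M.elems) : IsSimplex T :=
  ⟨M.card_eq T hT, M.affineIndependent T hT⟩

theorem IsSimplex.affineSpan_eq_top (h : IsSimplex T) :
    affineSpan ℝ (Set.range fun p : T => (p : Pt d)) = ⊤ := by
  rw [h.2.affineSpan_eq_top_iff_card_eq_finrank_add_one]
  simp [h.1]

noncomputable def IsSimplex.basis (h : IsSimplex T) : AffineBasis T ℝ (Pt d) :=
  ⟨fun p => p, h.2, h.affineSpan_eq_top⟩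

open Classical in
/-- The barycentric coordinate of the simplex `T` that belongs to `p`; zero if `p` is not a vertex
of `T`. -/
noncomputable def bary (T : Finset (Pt d)) (p : Pt d) : Pt d →ᵃ[ℝ] ℝ :=
  if h : IsSimplex T ∧ p ∈ T then h.1.basis.coord ⟨p, h.2⟩ else 0

theorem bary_eq_coord (h : IsSimplex T) (p : T) : bary T p = h.basis.coord p := by
  rw [bary, dif_pos ⟨h, p.2⟩]

theorem bary_of_notMem {p : Pt d} (hp : p ∉ T) (x : Pt d) : bary T p x = 0 := by
  rw [bary, dif_neg fun h => hp h.2]; rfl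

theorem sum_bary (h : IsSimplex T) (x : Pt d) : ∑ p ∈ T, bary T p x = 1 := by
  rw [← Finset.sum_coe_sort T]
  simp only [bary_eq_coord h]
  exact h.basis.sum_coord_apply_eq_one x

theorem sum_bary_smul (h : IsSimplex T) (x : Pt d) : ∑ p ∈ T, bary T p x • p = x := by
  rw [← Finset.sum_coe_sort T]
  simp only [bary_eq_coord h]
  exact h.basis.linear_combination_coord_eq_self x

theorem bary_eq_of_combination (h : IsSimplex T) {w : Pt d → ℝ} {x : Pt d}
    (hw : ∑ p ∈ T, w p = 1) (hx : ∑ p ∈ T, w p • p = x) {p : Pt d} (hp : p ∈ T) :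
    bary T p x = w p := by
  have h1 : ∑ q : T, w q = 1 := by rw [Finset.sum_coe_sort T (fun q => w q)]; exact hw
  have h2 := h.basis.coord_apply_combination_of_mem (s := Finset.univ) (i := ⟨p, hp⟩)
    (Finset.mem_univ _) (w := fun q => w q) h1
  rw [Finset.univ.affineCombination_eq_linear_combination _ _ h1] at h2
  have h3 : ∑ q : T, w q • h.basis q = x := by
    rw [← hx, ← Finset.sum_coe_sort T]; rfl
  rw [h3] at h2
  exact (congrArg (fun f : Pt d →ᵃ[ℝ] ℝ => f x) (bary_eq_coord h ⟨p, hp⟩)).trans h2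

theorem bary_self (h : IsSimplex T) {p : Pt d} (hp : p ∈ T) : bary T p p = 1 :=
  (congrArg (fun f : Pt d →ᵃ[ℝ] ℝ => f p) (bary_eq_coord h ⟨p, hp⟩)).trans
    (h.basis.coord_apply_eq ⟨p, hp⟩)

theorem bary_vertex_of_ne (h : IsSimplex T) {p q : Pt d} (hq : q ∈ T) (hpq : p ≠ q) :
    bary T p q = 0 := by
  by_cases hp : p ∈ T
  · exact (congrArg (fun f : Pt d →ᵃ[ℝ] ℝ => f q) (bary_eq_coord h ⟨p, hp⟩)).trans
      (h.basis.coord_apply_ne (i := ⟨p, hp⟩) (j := ⟨q, hq⟩) (by simpa [Subtype.ext_iff] using hpq))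
  · exact bary_of_notMem hp q

theorem hull_eq_convexHull_range (h : IsSimplex T) :
    hull T = convexHull ℝ (Set.range h.basis) := by
  have : Set.range h.basis = (T : Set (Pt d)) := Subtype.range_coe
  rw [this]; rfl

theorem mem_hull_iff (h : IsSimplex T) {x : Pt d} : x ∈ hull T ↔ ∀ p ∈ T, 0 ≤ bary T p x := by
  rw [hull_eq_convexHull_range h, h.basis.convexHull_eq_nonneg_coord]
  simp only [Set.mem_ofPred_eq, ← bary_eq_coord h, Subtype.forall]

theorem mem_interior_hull_iff (h : IsSimplex T) {x : Pt d} :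
    x ∈ interior (hull T) ↔ ∀ p ∈ T, 0 < bary T p x := by
  rw [hull_eq_convexHull_range h, h.basis.interior_convexHull]
  simp only [Set.mem_ofPred_eq, ← bary_eq_coord h, Subtype.forall]

theorem bary_nonneg (h : IsSimplex T) {x : Pt d} (hx : x ∈ hull T) (p : Pt d) :
    0 ≤ bary T p x := by
  by_cases hp : p ∈ T
  · exact (mem_hull_iff h).1 hx p hp
  · rw [bary_of_notMem hp]

theorem bary_le_one (h : IsSimplex T) {x : Pt d} (hx : x ∈ hull T) (p : Pt d) :
    bary T p x ≤ 1 := by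
  by_cases hp : p ∈ T
  · rw [← sum_bary h x]
    exact Finset.single_le_sum (f := fun p => bary T p x) (fun q _ => bary_nonneg h hx q) hp
  · rw [bary_of_notMem hp]; exact zero_le_one

theorem continuous_bary (p : Pt d) : Continuous (bary T p) :=
  (bary T p).continuous_of_finiteDimensional

theorem exists_polyFun_eq_affineMap (f : Pt d →ᵃ[ℝ] ℝ) :
    ∃ q : MvPolynomial (Fin d) ℝ, q.totalDegree ≤ 1 ∧ ∀ x, f x = polyFun q x := by
  refine ⟨MvPolynomial.C (f 0) + ∑ j, f.linear (EuclideanSpace.single j 1) • MvPolynomial.X j,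
    ?_, fun x => ?_⟩
  · refine (MvPolynomial.totalDegree_add _ _).trans (max_le (by simp) ?_)
    refine MvPolynomial.totalDegree_finsetSum_le fun j _ => ?_
    exact (MvPolynomial.totalDegree_smul_le _ _).trans (by simp)
  · have h1 : f x = f.linear x + f 0 := by
      have := f.decomp
      exact congrFun this x
    have h2 : x = ∑ j, x j • EuclideanSpace.single j (1 : ℝ) := by
      ext i; simp [Pi.single_apply]
    rw [h1, add_comm]
    conv_lhs => rw [h2]
    simp [polyFun, map_sum, mul_comm]

theorem isCompact_hull (T : Finset (Pt d)) : IsCompact (hull T) :=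
  T.finite_toSet.isCompact_convexHull (𝕜 := ℝ)

theorem convex_hull (T : Finset (Pt d)) : Convex ℝ (hull T) := convex_convexHull ℝ _

theorem vertex_mem_hull {p : Pt d} (hp : p ∈ T) : p ∈ hull T :=
  subset_convexHull ℝ _ hp

theorem volume_frontier_hull (T : Finset (Pt d)) : volume (frontier (hull T)) = 0 :=
  (convex_hull T).addHaar_frontier volume

theorem interior_hull_nonempty (h : IsSimplex T) : (interior (hull T)).Nonempty := by
  rw [hull_eq_convexHull_range h, interior_convexHull_nonempty_iff_affineSpan_eq_top]
  exact h.affineSpan_eq_top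

theorem volume_hull_pos (h : IsSimplex T) : 0 < volume.real (hull T) := by
  refine ENNReal.toReal_pos ?_ (isCompact_hull T).measure_lt_top.ne
  exact ((isOpen_interior.measure_pos volume (interior_hull_nonempty h)).trans_le
    (measure_mono interior_subset)).ne'

/-- The barycentric coordinate of `p` grows by one from `q` to `p`, hence by `2ρ / dist p q` along
the diameter of the inscribed ball in that direction. It stays in `[0, 1]` on the simplex, so every
edge is at least as long as the ball is wide. -/
theorem mul_diam_le_dist_of_closedBall_subset (h : IsSimplex T) {C : ℝ} (hC : 0 ≤ C) {x : Pt d}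
    (hx : Metric.closedBall x (C * Metric.diam (hull T) / 2) ⊆ hull T) {p q : Pt d} (hp : p ∈ T)
    (hq : q ∈ T) (hpq : p ≠ q) : C * Metric.diam (hull T) ≤ dist p q := by
  set ρ := C * Metric.diam (hull T) / 2
  have hρ : 0 ≤ ρ := by have := Metric.diam_nonneg (s := hull T); positivity
  have hn : 0 < dist p q := dist_pos.2 hpq
  set u : Pt d := (ρ / dist p q) • (p - q)
  have hu : ‖u‖ = ρ := by
    rw [norm_smul, ← dist_eq_norm, Real.norm_of_nonneg (by positivity), div_mul_cancel₀ _ hn.ne']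
  have h1 : x + u ∈ hull T := hx (by simp [hu])
  have h2 : x - u ∈ hull T := hx (by simp [hu])
  have h3 := bary_le_one h h1 p
  have h4 := bary_nonneg h h2 p
  have h5 : bary T p (x + u) - bary T p (x - u) = (bary T p).linear ((2 : ℝ) • u) := by
    have := (bary T p).linearMap_vsub (x + u) (x - u)
    rw [vsub_eq_sub, vsub_eq_sub] at this
    rw [← this]
    congr 1
    module
  have h6 : (bary T p).linear (p - q) = 1 := by
    have := (bary T p).linearMap_vsub p q
    rw [vsub_eq_sub, vsub_eq_sub, bary_self h hp, bary_vertex_of_ne h hq hpq, sub_zero] at this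
    exact this
  have h7 : (2 : ℝ) • u = (2 * ρ / dist p q) • (p - q) := by
    simp only [u, smul_smul]; congr 1; ring
  rw [h7, map_smul, h6, smul_eq_mul, mul_one] at h5
  have h8 : 2 * ρ / dist p q ≤ 1 := by linarith
  rw [div_le_one hn] at h8
  simp only [ρ] at h8
  linarith

end Simplex

/-! ### Integration over unions of elements -/

namespace Mesh

variable {d : ℕ} (M : Mesh d)

/-- Distinct elements have equally many vertices, so some vertex `p` of `T` is not in `T'`. By
conformity the coordinate of `p` vanishes on the intersection, whereas it is positive inside `T`. -/
theorem hull_inter_hull_subset_frontier {T T' : Finset (Pt d)} (hT : T ∈ M.elems)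
    (hT' : T' ∈ M.elems) (hne : T ≠ T') : hull T ∩ hull T' ⊆ frontier (hull T) := by
  intro x hx
  have hs := M.isSimplex hT
  obtain ⟨p, hpT, hpT'⟩ : ∃ p ∈ T, p ∉ T' := by
    by_contra hcon
    push Not at hcon
    exact hne (Finset.eq_of_subset_of_card_le hcon (by rw [M.card_eq T hT, M.card_eq T' hT']))
  refine ⟨subset_closure hx.1, fun hint => ?_⟩
  have hpos := (mem_interior_hull_iff hs).1 hint p hpT
  have hsub : convexHull ℝ ((T : Set (Pt d)) ∩ T') ⊆ {y | bary T p y = 0} := by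
    refine convexHull_min ?_ ((convex_singleton (0 : ℝ)).affine_preimage (bary T p))
    rintro q ⟨hq, hq'⟩
    exact bary_vertex_of_ne hs hq fun h => hpT' (h ▸ hq')
  exact hpos.ne' (hsub (M.conforming T hT T' hT' hx))

theorem disjoint_interior_hull {T T' : Finset (Pt d)} (hT : T ∈ M.elems)
    (hT' : T' ∈ M.elems) (hne : T ≠ T') : Disjoint (interior (hull T)) (interior (hull T')) := by
  rw [Set.disjoint_left]
  intro x hx hx'
  exact (M.hull_inter_hull_subset_frontier hT hT' hne
    ⟨interior_subset hx, interior_subset hx'⟩).2 hx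

end Mesh

section Region

variable {d : ℕ} {S : Finset (Finset (Pt d))}

theorem isCompact_biUnion_hull (S : Finset (Finset (Pt d))) : IsCompact (⋃ T ∈ S, hull T) :=
  S.isCompact_biUnion fun T _ => isCompact_hull T

theorem isOpen_region (S : Finset (Finset (Pt d))) : IsOpen (region S) := isOpen_interior

theorem region_subset (S : Finset (Finset (Pt d))) : region S ⊆ ⋃ T ∈ S, hull T := interior_subset

theorem closure_region_subset (S : Finset (Finset (Pt d))) :
    closure (region S) ⊆ ⋃ T ∈ S, hull T :=
  closure_minimal (region_subset S) (isCompact_biUnion_hull S).isClosed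

theorem interior_hull_subset_region {T : Finset (Pt d)} (hT : T ∈ S) :
    interior (hull T) ⊆ region S :=
  interior_mono (Set.subset_biUnion_of_mem (u := fun T => hull T) hT)

theorem region_mono {S S' : Finset (Finset (Pt d))} (h : S ⊆ S') : region S ⊆ region S' :=
  interior_mono (Set.biUnion_subset_biUnion_left h)

/-- Boundaries of convex sets are null, so integrals over a region split into integrals over
disjoint open simplices. -/
theorem region_ae_eq (S : Finset (Finset (Pt d))) :
    region S =ᵐ[volume] ⋃ T ∈ S, interior (hull T) := by
  refine Filter.EventuallyLE.antisymm ?_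
    (LE.le.eventuallyLE (Set.iUnion₂_subset fun T hT => interior_hull_subset_region hT))
  rw [ae_le_set]
  refine measure_mono_null (t := ⋃ T ∈ S, frontier (hull T)) ?_
    ((measure_biUnion_null_iff S.countable_toSet).2 fun T _ => volume_frontier_hull T)
  rintro x ⟨hx, hx'⟩
  obtain ⟨T, hT, hxT⟩ := Set.mem_iUnion₂.1 (region_subset S hx)
  refine Set.mem_iUnion₂.2 ⟨T, hT, subset_closure hxT, fun h => hx' (Set.mem_iUnion₂.2 ⟨T, hT, h⟩)⟩

theorem ae_region {P : Pt d → Prop} (h : ∀ T ∈ S, ∀ x ∈ interior (hull T), P x) :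
    ∀ᵐ x ∂volume.restrict (region S), P x := by
  rw [Measure.restrict_congr_set (region_ae_eq S)]
  refine (ae_restrict_iff' (S.measurableSet_biUnion fun T _ =>
    isOpen_interior.measurableSet)).2 (Filter.Eventually.of_forall fun x hx => ?_)
  obtain ⟨T, hT, hxT⟩ := Set.mem_iUnion₂.1 hx
  exact h T hT x hxT

theorem interior_hull_ae_eq (T : Finset (Pt d)) : interior (hull T) =ᵐ[volume] hull T :=
  interior_ae_eq_of_null_frontier (volume_frontier_hull T)

theorem ae_hull {T : Finset (Pt d)} {P : Pt d → Prop} (h : ∀ x ∈ interior (hull T), P x) :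
    ∀ᵐ x ∂volume.restrict (hull T), P x := by
  rw [← Measure.restrict_congr_set (interior_hull_ae_eq T)]
  exact (ae_restrict_iff' isOpen_interior.measurableSet).2 (Filter.Eventually.of_forall h)

theorem volume_region_lt_top (S : Finset (Finset (Pt d))) : volume (region S) < ⊤ :=
  (measure_mono (region_subset S)).trans_lt (isCompact_biUnion_hull S).measure_lt_top

instance (S : Finset (Finset (Pt d))) : IsFiniteMeasure (volume.restrict (region S)) :=
  ⟨by rw [Measure.restrict_apply_univ]; exact volume_region_lt_top S⟩

theorem Mesh.setIntegral_region (M : Mesh d) (hS : S ⊆ M.elems) {f : Pt d → ℝ}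
    (hf : IntegrableOn f (region S) volume) :
    ∫ x in region S, f x = ∑ T ∈ S, ∫ x in hull T, f x := by
  rw [setIntegral_congr_set (region_ae_eq S), integral_biUnion_finset]
  · exact Finset.sum_congr rfl fun T _ => setIntegral_congr_set (interior_hull_ae_eq T)
  · exact fun T _ => isOpen_interior.measurableSet
  · exact fun T hT T' hT' h => M.disjoint_interior_hull (hS hT) (hS hT') h
  · exact fun T hT => hf.mono_set (interior_hull_subset_region hT)

theorem Mesh.sum_volume_hull_le (M : Mesh d) (hS : S ⊆ M.elems) {K : Set (Pt d)}
    (hK : ∀ T ∈ S, hull T ⊆ K) (hKf : volume K ≠ ⊤) :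
    ∑ T ∈ S, volume.real (hull T) ≤ volume.real K := by
  have h1 : ∑ T ∈ S, volume.real (hull T) = volume.real (region S) := by
    have := M.setIntegral_region hS (f := fun _ => 1)
      (integrableOn_const (volume_region_lt_top S).ne)
    simpa using this.symm
  rw [h1]
  exact measureReal_mono ((region_subset S).trans (Set.iUnion₂_subset hK)) hKf

end Region

/-! ### Unisolvence of the Lagrange nodes -/

theorem totalDegree_aeval_le {σ τ : Type*} (g : σ → MvPolynomial τ ℝ)
    (hg : ∀ j, (g j).totalDegree ≤ 1) (q : MvPolynomial σ ℝ) :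
    (MvPolynomial.aeval g q).totalDegree ≤ q.totalDegree := by
  rw [MvPolynomial.aeval_def, MvPolynomial.eval₂_eq]
  refine MvPolynomial.totalDegree_finsetSum_le fun m hm => ?_
  refine (MvPolynomial.totalDegree_mul _ _).trans ?_
  have h1 : (algebraMap ℝ (MvPolynomial τ ℝ) (MvPolynomial.coeff m q)).totalDegree = 0 :=
    MvPolynomial.totalDegree_C _
  rw [h1, zero_add]
  refine (MvPolynomial.totalDegree_finsetProd _ _).trans ?_
  refine le_trans (Finset.sum_le_sum fun j _ => ?_) (MvPolynomial.le_totalDegree hm)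
  exact (MvPolynomial.totalDegree_pow _ _).trans
    ((Nat.mul_le_mul_left _ (hg j)).trans (Nat.mul_one _).le)

/-- The combinatorial Nullstellensatz for a monomial `m` of top degree gives a nonzero value on the
grid of points with `s i ≤ m i`; their coordinate sum is at most the degree of `m`. -/
theorem exists_nat_eval_ne_zero {σ : Type*} [Fintype σ] {f : MvPolynomial σ ℝ} (hf : f ≠ 0) :
    ∃ s : σ → ℕ, ∑ i, s i ≤ f.totalDegree ∧ MvPolynomial.eval (fun i => (s i : ℝ)) f ≠ 0 := by
  classical
  obtain ⟨m, hm, hdeg⟩ := Finset.exists_mem_eq_sup f.support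
    (MvPolynomial.support_nonempty.2 hf) (fun m => m.sum fun _ e => e)
  have hdeg' : f.totalDegree = m.degree := hdeg
  obtain ⟨t, ht, hne⟩ := MvPolynomial.combinatorial_nullstellensatz_exists_eval_nonzero f m
    (MvPolynomial.mem_support_iff.1 hm) hdeg'
    (fun i => (Finset.range (m i + 1)).image (Nat.cast : ℕ → ℝ)) (fun i => by
      rw [Finset.card_image_of_injective _ Nat.cast_injective]; simp)
  simp only [Finset.mem_image, Finset.mem_range] at ht
  choose s hs hst using ht
  refine ⟨s, ?_, ?_⟩
  · rw [hdeg', Finsupp.degree_eq_sum]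
    exact Finset.sum_le_sum fun i _ => Nat.lt_succ_iff.1 (hs i)
  · have : (fun i => (s i : ℝ)) = t := funext hst
    rw [this]
    exact hne

/-- In affine coordinates with origin at one vertex and the edges scaled by `1 / r`, the Lagrange
nodes are exactly the points with natural coordinates of sum at most `r`, where
`exists_nat_eval_ne_zero` applies. -/
theorem polyFun_eq_zero_of_nodes {d r : ℕ} (hr : 1 ≤ r) {T : Finset (Pt d)} (hT : IsSimplex T)
    {q : MvPolynomial (Fin d) ℝ} (hq : q.totalDegree ≤ r) (h0 : ∀ y ∈ nodes r T, polyFun q y = 0)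
    (x : Pt d) : polyFun q x = 0 := by
  classical
  have hr0 : (r : ℝ) ≠ 0 := by positivity
  set e : Fin (d + 1) ≃ T := (T.equivFinOfCardEq hT.1).symm
  set P : Fin (d + 1) → Pt d := fun i => e i
  have hsumT : ∀ g : Pt d → Pt d, ∑ p ∈ T, g p = g (P 0) + ∑ i : Fin d, g (P i.succ) := by
    intro g
    rw [← Finset.sum_coe_sort T, ← e.sum_comp, Fin.sum_univ_succ]
  have hsumT' : ∀ g : Pt d → ℝ, ∑ p ∈ T, g p = g (P 0) + ∑ i : Fin d, g (P i.succ) := by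
    intro g
    rw [← Finset.sum_coe_sort T, ← e.sum_comp, Fin.sum_univ_succ]
  have hsumN : ∀ g : Pt d → ℕ, ∑ p ∈ T, g p = g (P 0) + ∑ i : Fin d, g (P i.succ) := by
    intro g
    rw [← Finset.sum_coe_sort T, ← e.sum_comp, Fin.sum_univ_succ]
  set g : Fin d → MvPolynomial (Fin d) ℝ := fun j => MvPolynomial.C (P 0 j) +
    ∑ i : Fin d, ((P i.succ j - P 0 j) / r) • MvPolynomial.X i
  have hg : ∀ j, (g j).totalDegree ≤ 1 := fun j => by
    refine (MvPolynomial.totalDegree_add _ _).trans (max_le (by simp) ?_)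
    refine MvPolynomial.totalDegree_finsetSum_le fun i _ => ?_
    exact (MvPolynomial.totalDegree_smul_le _ _).trans (by simp)
  set f := MvPolynomial.aeval g q
  have hfe : ∀ s : Fin d → ℝ, MvPolynomial.eval s f =
      polyFun q (P 0 + ∑ i, (s i / r) • (P i.succ - P 0)) := by
    intro s
    simp only [f]
    rw [polyFun, MvPolynomial.aeval_def, MvPolynomial.hom_eval₂, MvPolynomial.eval,
      MvPolynomial.coe_eval₂Hom]
    congr 1
    · ext a; simp
    · funext j
      simp only [g, MvPolynomial.smul_eq_C_mul]
      simp
      exact Finset.sum_congr rfl fun i _ => by ring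
  have hf0 : f = 0 := by
    by_contra hf
    obtain ⟨s, hs, hne⟩ := exists_nat_eval_ne_zero hf
    have hsr : ∑ i, s i ≤ r := hs.trans ((totalDegree_aeval_le g hg q).trans hq)
    refine hne ?_
    rw [hfe]
    -- The vertex `P 0` receives the remaining weight `r - ∑ s`, the others receive `s`.
    refine h0 _ ⟨fun p => if h : p ∈ T then
      (Fin.cons (r - ∑ i, s i) s : Fin (d + 1) → ℕ) (e.symm ⟨p, h⟩) else 0, ?_, ?_⟩
    · rw [hsumN]
      simp [P]
      omega
    · rw [hsumT]
      simp [P]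
      rw [Nat.cast_sub hsr, Nat.cast_sum]
      simp only [smul_sub, Finset.sum_sub_distrib, ← Finset.sum_smul, ← Finset.sum_div, sub_div,
        div_self hr0, sub_smul, one_smul]
      abel
  have hx : x = P 0 + ∑ i : Fin d, ((r * bary T (P i.succ) x) / r) • (P i.succ - P 0) := by
    have h1 := sum_bary_smul hT x
    have h2 := sum_bary hT x
    rw [hsumT] at h1
    rw [hsumT'] at h2
    conv_lhs => rw [← h1]
    have h3 : bary T (P 0) x = 1 - ∑ i : Fin d, bary T (P i.succ) x := by linarith
    rw [h3]
    simp only [mul_div_cancel_left₀ _ hr0, smul_sub, Finset.sum_sub_distrib, ← Finset.sum_smul,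
      sub_smul, one_smul]
    abel
  rw [hx, ← hfe, hf0, map_zero]

/-! ### Hat functions and the nodal basis -/

theorem bary_eq_of_subset_combination {d : ℕ} {T F : Finset (Pt d)} (hT : IsSimplex T) (hF : F ⊆ T)
    {w : Pt d → ℝ} {x : Pt d} (hw0 : ∀ p ∉ F, w p = 0)
    (hw : ∑ p ∈ F, w p = 1) (hx : ∑ p ∈ F, w p • p = x) (p : Pt d) : bary T p x = w p := by
  by_cases hp : p ∈ T
  · refine bary_eq_of_combination hT ?_ ?_ hp
    · rw [← hw]; exact (Finset.sum_subset hF fun q _ hq => hw0 q hq).symm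
    · rw [← hx]; exact (Finset.sum_subset hF fun q _ hq => by rw [hw0 q hq, zero_smul]).symm
  · rw [bary_of_notMem hp, hw0 p fun h => hp (hF h)]

namespace Mesh

variable {d : ℕ} (M : Mesh d)

/-- By conformity `x` is a convex combination of the common vertices, and these weights are its
coordinates in both elements. This makes the hat functions well defined. -/
theorem bary_eq_bary {T T' : Finset (Pt d)} (hT : T ∈ M.elems) (hT' : T' ∈ M.elems) {x : Pt d}
    (hx : x ∈ hull T) (hx' : x ∈ hull T') (p : Pt d) : bary T p x = bary T' p x := by
  classical
  have h := M.conforming T hT T' hT' ⟨hx, hx'⟩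
  rw [← Finset.coe_inter, Finset.mem_convexHull'] at h
  obtain ⟨w, -, hw1, hw2⟩ := h
  set w' : Pt d → ℝ := fun p => if p ∈ T ∩ T' then w p else 0
  have h0 : ∀ p ∉ T ∩ T', w' p = 0 := fun p hp => if_neg hp
  have h1 : ∑ p ∈ T ∩ T', w' p = 1 := by
    rw [← hw1]; exact Finset.sum_congr rfl fun p hp => if_pos hp
  have h2 : ∑ p ∈ T ∩ T', w' p • p = x := by
    rw [← hw2]; exact Finset.sum_congr rfl fun p hp => by simp only [w', if_pos hp]
  rw [bary_eq_of_subset_combination (M.isSimplex hT) Finset.inter_subset_left h0 h1 h2,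
    bary_eq_of_subset_combination (M.isSimplex hT') Finset.inter_subset_right h0 h1 h2]

/-- The closed set covered by the mesh. -/
def carrier : Set (Pt d) := ⋃ T ∈ M.elems, hull T

open Classical in
/-- The vertices of the mesh. -/
noncomputable def vertices : Finset (Pt d) := M.elems.biUnion id

open Classical in
/-- The piecewise linear function on the mesh that belongs to the vertex `p`. -/
noncomputable def hat (p x : Pt d) : ℝ :=
  if h : ∃ T ∈ M.elems, x ∈ hull T then bary h.choose p x else 0

theorem hull_subset_carrier {T : Finset (Pt d)} (hT : T ∈ M.elems) : hull T ⊆ M.carrier :=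
  Set.subset_biUnion_of_mem (u := fun T => hull T) hT

theorem mem_carrier {x : Pt d} : x ∈ M.carrier ↔ ∃ T ∈ M.elems, x ∈ hull T := by
  simp [carrier]

theorem Ω_subset_carrier : M.Ω ⊆ M.carrier := region_subset _

theorem isOpen_Ω : IsOpen M.Ω := isOpen_region _

theorem subset_vertices {T : Finset (Pt d)} (hT : T ∈ M.elems) : T ⊆ M.vertices := by
  classical
  intro p hp
  rw [vertices, Finset.mem_biUnion]
  exact ⟨T, hT, hp⟩

theorem hat_eq_bary {T : Finset (Pt d)} (hT : T ∈ M.elems) {x : Pt d} (hx : x ∈ hull T)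
    (p : Pt d) : M.hat p x = bary T p x := by
  have h : ∃ T ∈ M.elems, x ∈ hull T := ⟨T, hT, hx⟩
  rw [hat, dif_pos h]
  exact M.bary_eq_bary h.choose_spec.1 hT h.choose_spec.2 hx p

theorem hat_nonneg {x : Pt d} (hx : x ∈ M.carrier) (p : Pt d) : 0 ≤ M.hat p x := by
  obtain ⟨T, hT, hx⟩ := M.mem_carrier.1 hx
  rw [M.hat_eq_bary hT hx]
  exact bary_nonneg (M.isSimplex hT) hx p

theorem hat_le_one {x : Pt d} (hx : x ∈ M.carrier) (p : Pt d) : M.hat p x ≤ 1 := by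
  obtain ⟨T, hT, hx⟩ := M.mem_carrier.1 hx
  rw [M.hat_eq_bary hT hx]
  exact bary_le_one (M.isSimplex hT) hx p

theorem hat_of_notMem {T : Finset (Pt d)} (hT : T ∈ M.elems) {x : Pt d} (hx : x ∈ hull T)
    {p : Pt d} (hp : p ∉ T) : M.hat p x = 0 := by
  rw [M.hat_eq_bary hT hx, bary_of_notMem hp]

theorem sum_hat {x : Pt d} (hx : x ∈ M.carrier) : ∑ p ∈ M.vertices, M.hat p x = 1 := by
  obtain ⟨T, hT, hx⟩ := M.mem_carrier.1 hx
  rw [← sum_bary (M.isSimplex hT) x, ← Finset.sum_subset (M.subset_vertices hT)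
    fun p _ hp => M.hat_of_notMem hT hx hp]
  exact Finset.sum_congr rfl fun p _ => M.hat_eq_bary hT hx p

theorem sum_hat_smul {x : Pt d} (hx : x ∈ M.carrier) : ∑ p ∈ M.vertices, M.hat p x • p = x := by
  obtain ⟨T, hT, hx⟩ := M.mem_carrier.1 hx
  conv_rhs => rw [← sum_bary_smul (M.isSimplex hT) x]
  rw [← Finset.sum_subset (M.subset_vertices hT)
    fun p _ hp => by rw [M.hat_of_notMem hT hx hp, zero_smul]]
  exact Finset.sum_congr rfl fun p _ => by rw [M.hat_eq_bary hT hx p]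

theorem eq_of_hat_eq {x y : Pt d} (hx : x ∈ M.carrier) (hy : y ∈ M.carrier)
    (h : ∀ p ∈ M.vertices, M.hat p x = M.hat p y) : x = y := by
  rw [← M.sum_hat_smul hx, ← M.sum_hat_smul hy]
  exact Finset.sum_congr rfl fun p hp => by rw [h p hp]

theorem mem_hull_of_hat_eq_zero {F : Finset (Pt d)} {x : Pt d} (hx : x ∈ M.carrier)
    (h : ∀ p ∈ M.vertices, p ∉ F → M.hat p x = 0) : x ∈ hull F := by
  classical
  rw [← M.sum_hat_smul hx]
  have h1 := M.sum_hat hx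
  rw [← Finset.sum_subset (Finset.inter_subset_left (s₁ := M.vertices) (s₂ := F)) fun p hp hp' => by
    rw [h p hp fun hF => hp' (Finset.mem_inter.2 ⟨hp, hF⟩), zero_smul]]
  rw [← Finset.sum_subset (Finset.inter_subset_left (s₁ := M.vertices) (s₂ := F)) fun p hp hp' =>
    h p hp fun hF => hp' (Finset.mem_inter.2 ⟨hp, hF⟩)] at h1
  exact (convex_hull F).sum_mem (fun p _ => M.hat_nonneg hx p) h1
    fun p hp => vertex_mem_hull (Finset.mem_inter.1 hp).2

theorem continuousOn_hat (p : Pt d) : ContinuousOn (M.hat p) M.carrier := by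
  have h : M.carrier = ⋃ T : M.elems, hull (T : Finset (Pt d)) := by
    ext x; simp [carrier]
  rw [h]
  refine (locallyFinite_of_finite _).continuousOn_iUnion
    (fun T => (isCompact_hull T.1).isClosed) fun T => ?_
  exact ((continuous_bary p).continuousOn).congr fun x hx => M.hat_eq_bary T.2 hx p

theorem eventually_mem_star {l : Pt d} (hl : l ∈ M.Ω) :
    ∀ᶠ z in nhds l, ∃ T ∈ M.elems, l ∈ hull T ∧ z ∈ hull T := by
  have h1 : ∀ᶠ z in nhds l, z ∈ M.Ω := M.isOpen_Ω.mem_nhds hl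
  have h2 : ∀ᶠ z in nhds l, ∀ T ∈ M.elems, l ∉ hull T → z ∉ hull T := by
    rw [Filter.eventually_all_finset]
    intro T _
    by_cases h : l ∈ hull T
    · simp [h]
    · filter_upwards [(isCompact_hull T).isClosed.isOpen_compl.mem_nhds h] with z hz _ using hz
  filter_upwards [h1, h2] with z hz1 hz2
  obtain ⟨T, hT, hzT⟩ := M.mem_carrier.1 (M.Ω_subset_carrier hz1)
  exact ⟨T, hT, by_contra fun h => hz2 T hT h hzT, hzT⟩

/-- Points in the relative interior of the same face have the same local picture of the mesh.
Extending the segment from `l` through `x` a little gives a point `y` of the face, and the homothety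
with centre `y` taking `l` to `x` carries a neighbourhood of `l` in the star of `l` to a
neighbourhood of `x`, without leaving any of these elements. -/
theorem mem_Ω_of_support_eq {l x : Pt d} (hl : l ∈ M.Ω) (hx : x ∈ M.carrier)
    (h : ∀ p ∈ M.vertices, M.hat p l = 0 ↔ M.hat p x = 0) : x ∈ M.Ω := by
  classical
  have hlc := M.Ω_subset_carrier hl
  set F := M.vertices.filter fun p => M.hat p x ≠ 0
  -- Overshooting by a `δ` below all positive coordinates of `x` keeps the coordinates of `y`
  -- nonnegative.
  obtain ⟨δ, hδ, hδF⟩ : ∃ δ > 0, ∀ p ∈ F, δ ≤ M.hat p x := by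
    have : ∀ p ∈ F, ∀ᶠ δ in nhdsWithin (0 : ℝ) (Set.Ioi 0), δ ≤ M.hat p x := fun p hp => by
      have hpos : 0 < M.hat p x :=
        lt_of_le_of_ne (M.hat_nonneg hx p) (Finset.mem_filter.1 hp).2.symm
      exact (eventually_lt_nhds hpos).filter_mono nhdsWithin_le_nhds |>.mono fun _ h => h.le
    have h2 := (Filter.eventually_all_finset F).2 this
    obtain ⟨δ, h3, h4⟩ := (h2.and self_mem_nhdsWithin).exists
    exact ⟨δ, h4, h3⟩
  have hFsub : ∀ T ∈ M.elems, l ∈ hull T → F ⊆ T := by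
    intro T hT hlT p hp
    by_contra hpT
    have hpm := Finset.mem_filter.1 hp
    exact hpm.2 ((h p hpm.1).1 (M.hat_of_notMem hT hlT hpT))
  set y : Pt d := x + δ • (x - l)
  have hy : y ∈ hull F := by
    have e1 : ∑ p ∈ M.vertices, (M.hat p x + δ * (M.hat p x - M.hat p l)) = 1 := by
      rw [Finset.sum_add_distrib, ← Finset.mul_sum, Finset.sum_sub_distrib, M.sum_hat hx,
        M.sum_hat hlc]
      ring
    have e2 : ∑ p ∈ M.vertices, (M.hat p x + δ * (M.hat p x - M.hat p l)) • p = y := by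
      simp only [add_smul, mul_smul, sub_smul, Finset.sum_add_distrib, ← Finset.smul_sum,
        Finset.sum_sub_distrib, M.sum_hat_smul hx, M.sum_hat_smul hlc, y]
    have hz : ∀ p ∈ M.vertices, p ∉ F → M.hat p x + δ * (M.hat p x - M.hat p l) = 0 := by
      intro p hp hpF
      have hpx : M.hat p x = 0 := by
        by_contra hne; exact hpF (Finset.mem_filter.2 ⟨hp, hne⟩)
      rw [hpx, (h p hp).2 hpx]; ring
    rw [← e2, ← Finset.sum_subset (Finset.filter_subset _ M.vertices) fun p hp hpF => by
      rw [hz p hp hpF, zero_smul]]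
    rw [← Finset.sum_subset (Finset.filter_subset _ M.vertices) hz] at e1
    refine (convex_hull F).sum_mem (fun p hp => ?_) e1 fun p hp => vertex_mem_hull hp
    have h1 := hδF p hp
    have h2 := M.hat_le_one hlc p
    have h3 := M.hat_nonneg hx p
    nlinarith
  -- The inverse of the homothety with centre `y` and ratio `δ / (1 + δ)`.
  set ψ : Pt d → Pt d := fun w => δ⁻¹ • ((1 + δ) • w - y)
  have hψc : Continuous ψ := by fun_prop
  have hψx : ψ x = l := by
    have : (1 + δ) • x - y = δ • l := by simp only [y]; module
    simp only [ψ, this, smul_smul, inv_mul_cancel₀ hδ.ne', one_smul]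
  have hev : ∀ᶠ w in nhds x, ∃ T ∈ M.elems, l ∈ hull T ∧ ψ w ∈ hull T :=
    hψc.continuousAt.eventually (by rw [hψx]; exact M.eventually_mem_star hl)
  refine mem_interior_iff_mem_nhds.2 ?_
  filter_upwards [hev] with w hw
  obtain ⟨T, hT, hlT, hwT⟩ := hw
  refine M.hull_subset_carrier hT ?_
  have hyT : y ∈ hull T := convexHull_mono (Finset.coe_subset.2 (hFsub T hT hlT)) hy
  have h1δ : 0 < 1 + δ := by linarith
  have := convex_hull T hyT hwT (a := 1 / (1 + δ)) (b := δ / (1 + δ)) (by positivity)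
    (by positivity) (by field_simp)
  convert this using 1
  simp only [ψ, smul_smul]
  have e : δ / (1 + δ) * δ⁻¹ = 1 / (1 + δ) := by field_simp
  rw [e, smul_sub, smul_smul, one_div, inv_mul_cancel₀ h1δ.ne']
  module

/-- If the face of `l` is contained in that of `x`, a small step from `l` towards `x` stays in the
open set `Ω` and reaches a point with the same support as `x`. -/
theorem mem_Ω_of_support_subset {l x : Pt d} (hl : l ∈ M.Ω) (hx : x ∈ M.carrier)
    (h : ∀ p ∈ M.vertices, M.hat p x = 0 → M.hat p l = 0) : x ∈ M.Ω := by
  have hlc := M.Ω_subset_carrier hl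
  obtain ⟨T, hT, hxT⟩ := M.mem_carrier.1 hx
  have hlT : l ∈ hull T :=
    M.mem_hull_of_hat_eq_zero hlc fun p hp hpT => h p hp (M.hat_of_notMem hT hxT hpT)
  have hc : Continuous fun ε : ℝ => l + ε • (x - l) := by fun_prop
  have hev : ∀ᶠ ε in nhds (0 : ℝ), l + ε • (x - l) ∈ M.Ω :=
    hc.continuousAt.eventually_mem (by simpa using M.isOpen_Ω.mem_nhds hl)
  have hev' : ∀ᶠ ε in nhdsWithin (0 : ℝ) (Set.Ioi 0), l + ε • (x - l) ∈ M.Ω ∧ ε < 1 :=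
    (hev.and (eventually_lt_nhds zero_lt_one)).filter_mono nhdsWithin_le_nhds
  obtain ⟨ε, ⟨hεΩ, hε1⟩, hε0⟩ := (hev'.and self_mem_nhdsWithin).exists
  have hε0 : 0 < ε := hε0
  refine M.mem_Ω_of_support_eq hεΩ hx fun p hp => ?_
  have hmem : l + ε • (x - l) ∈ hull T := by
    have := convex_hull T hlT hxT (by linarith : 0 ≤ 1 - ε) hε0.le (by ring)
    convert this using 1
    module
  have hb : bary T p (l + ε • (x - l)) = (1 - ε) * bary T p l + ε * bary T p x := by
    have : l + ε • (x - l) = AffineMap.lineMap l x ε := by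
      rw [AffineMap.lineMap_apply_module']; abel
    rw [this, AffineMap.apply_lineMap, AffineMap.lineMap_apply_module]; simp
  rw [M.hat_eq_bary hT hmem, hb, ← M.hat_eq_bary hT hxT, ← M.hat_eq_bary hT hlT]
  have h1 := M.hat_nonneg hlc p
  have h2 := M.hat_nonneg hx p
  constructor
  · intro h0
    nlinarith [mul_nonneg (by linarith : 0 ≤ 1 - ε) h1, mul_nonneg hε0.le h2]
  · intro h0
    rw [h0, h p hp h0]; ring

end Mesh

/-! ### Lagrange nodes and the nodal basis as products of hat functions. -/

theorem mul_bary_of_mem_nodes {d r : ℕ} (hr : 1 ≤ r) {T : Finset (Pt d)} (hT : IsSimplex T)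
    {l : Pt d} (hl : l ∈ nodes r T) : ∃ α : Pt d → ℕ, ∀ p, (r : ℝ) * bary T p l = α p := by
  classical
  obtain ⟨α, hα, rfl⟩ := hl
  have hr0 : (r : ℝ) ≠ 0 := by positivity
  refine ⟨fun p => if p ∈ T then α p else 0, fun p => ?_⟩
  by_cases hp : p ∈ T
  · rw [bary_eq_of_combination hT (w := fun p => (α p : ℝ) / r) ?_ rfl hp]
    · simp only [if_pos hp]; field_simp
    · rw [← Finset.sum_div, ← Nat.cast_sum, hα, div_self hr0]
  · rw [bary_of_notMem hp]; simp [hp]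

theorem nodes_subset_hull {d r : ℕ} (hr : 1 ≤ r) {T : Finset (Pt d)} : nodes r T ⊆ hull T := by
  rintro _ ⟨α, hα, rfl⟩
  have hr0 : (r : ℝ) ≠ 0 := by positivity
  refine (convex_hull T).sum_mem (fun p _ => by positivity) ?_ fun p hp => vertex_mem_hull hp
  rw [← Finset.sum_div, ← Nat.cast_sum, hα, div_self hr0]

theorem finite_nodes_and_ncard_le {d : ℕ} (r : ℕ) {T : Finset (Pt d)} (hT : IsSimplex T) :
    (nodes r T).Finite ∧ (nodes r T).ncard ≤ (r + 1) ^ (d + 1) := by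
  classical
  set F : (T → Fin (r + 1)) → Pt d := fun β => ∑ p : T, (((β p : ℕ) : ℝ) / (r : ℝ)) • (p : Pt d)
  have hsub : nodes r T ⊆ Set.range F := by
    rintro _ ⟨α, hα, rfl⟩
    refine ⟨fun p => ⟨α p, Nat.lt_succ_of_le ?_⟩, ?_⟩
    · rw [← hα]; exact Finset.single_le_sum (fun _ _ => Nat.zero_le _) p.2
    · exact Finset.sum_coe_sort T (fun p => ((α p : ℝ) / (r : ℝ)) • p)
  refine ⟨(Set.finite_range F).subset hsub, (Set.ncard_le_ncard hsub (Set.finite_range F)).trans ?_⟩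
  rw [← Set.image_univ]
  refine (Set.ncard_image_le Set.finite_univ).trans ?_
  rw [Set.ncard_univ, Nat.card_eq_fintype_card]
  simp [hT.1]

namespace Mesh

variable {d : ℕ} (M : Mesh d) (r : ℕ)

/-- The Lagrange nodes of the mesh, those on the boundary included. -/
def lattice : Set (Pt d) := {x | ∃ T ∈ M.elems, x ∈ nodes r T}

/-- The barycentric multi-index of a Lagrange node. -/
noncomputable def nodeIdx (l p : Pt d) : ℕ := ⌊(r : ℝ) * M.hat p l⌋₊

/-- The Lagrange basis function of the node `l` on the closed set covered by the mesh, as a product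
of piecewise linear functions. -/
noncomputable def lagrangeFun (l x : Pt d) : ℝ :=
  ∏ p ∈ M.vertices, ∏ s ∈ Finset.range (M.nodeIdx r l p),
    (((r : ℝ) * M.hat p x - s) / ((M.nodeIdx r l p : ℝ) - s))

variable {M r}

theorem lattice_subset_carrier (hr : 1 ≤ r) : M.lattice r ⊆ M.carrier := by
  rintro x ⟨T, hT, hx⟩
  exact M.hull_subset_carrier hT (nodes_subset_hull hr hx)

theorem nodeIdx_cast (hr : 1 ≤ r) {l : Pt d} (hl : l ∈ M.lattice r) (p : Pt d) :
    (M.nodeIdx r l p : ℝ) = r * M.hat p l := by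
  obtain ⟨T, hT, hlT⟩ := hl
  obtain ⟨α, hα⟩ := mul_bary_of_mem_nodes hr (M.isSimplex hT) hlT
  rw [nodeIdx, M.hat_eq_bary hT (nodes_subset_hull hr hlT), hα, Nat.floor_natCast]

theorem sum_nodeIdx (hr : 1 ≤ r) {l : Pt d} (hl : l ∈ M.lattice r) :
    ∑ p ∈ M.vertices, M.nodeIdx r l p = r := by
  have : (∑ p ∈ M.vertices, (M.nodeIdx r l p : ℝ)) = r := by
    simp only [nodeIdx_cast hr hl, ← Finset.mul_sum, M.sum_hat (lattice_subset_carrier hr hl),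
      mul_one]
  exact_mod_cast this

theorem lagrangeFun_self (hr : 1 ≤ r) {l : Pt d} (hl : l ∈ M.lattice r) :
    M.lagrangeFun r l l = 1 := by
  refine Finset.prod_eq_one fun p _ => Finset.prod_eq_one fun s hs => ?_
  rw [← nodeIdx_cast hr hl]
  have : (s : ℝ) < M.nodeIdx r l p := by exact_mod_cast Finset.mem_range.1 hs
  exact div_self (by linarith)

theorem lagrangeFun_eq_zero {l x p : Pt d} (hp : p ∈ M.vertices) {m : ℕ}
    (hm : m < M.nodeIdx r l p) (hx : (r : ℝ) * M.hat p x = m) : M.lagrangeFun r l x = 0 := by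
  refine Finset.prod_eq_zero hp (Finset.prod_eq_zero (Finset.mem_range.2 hm) ?_)
  rw [hx, sub_self, zero_div]

/-- Both multi-indices have sum `r`; if they differ, that of `y` is smaller in some coordinate, and
the matching factor is zero. -/
theorem lagrangeFun_of_ne (hr : 1 ≤ r) {l y : Pt d} (hl : l ∈ M.lattice r) (hy : y ∈ M.lattice r)
    (hne : y ≠ l) : M.lagrangeFun r l y = 0 := by
  obtain ⟨p, hp, hlt⟩ : ∃ p ∈ M.vertices, M.nodeIdx r y p < M.nodeIdx r l p := by
    by_contra hcon
    push Not at hcon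
    have h := (Finset.sum_eq_sum_iff_of_le hcon).1
      ((sum_nodeIdx hr hl).trans (sum_nodeIdx hr hy).symm)
    refine hne (M.eq_of_hat_eq (lattice_subset_carrier hr hy) (lattice_subset_carrier hr hl)
      fun p hp => ?_)
    have h1 := nodeIdx_cast hr hl p
    rw [h p hp, nodeIdx_cast hr hy] at h1
    exact mul_left_cancel₀ (by positivity) h1
  exact lagrangeFun_eq_zero hp hlt (nodeIdx_cast hr hy p).symm

theorem hat_eq_zero_of_lagrangeFun_ne_zero (hr : 1 ≤ r) {l x : Pt d} (hl : l ∈ M.lattice r)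
    (h : M.lagrangeFun r l x ≠ 0) {p : Pt d} (hp : p ∈ M.vertices) (hx : M.hat p x = 0) :
    M.hat p l = 0 := by
  by_contra hne
  refine h (lagrangeFun_eq_zero hp (m := 0) (Nat.pos_of_ne_zero fun h0 => hne ?_) (by simp [hx]))
  have := nodeIdx_cast hr hl p
  rw [h0, Nat.cast_zero] at this
  have hr0 : (r : ℝ) ≠ 0 := by positivity
  exact (mul_eq_zero.1 this.symm).resolve_left hr0

theorem lagrangeFun_of_notMem_hull (hr : 1 ≤ r) {l x : Pt d} (hl : l ∈ M.lattice r)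
    {T : Finset (Pt d)} (hT : T ∈ M.elems) (hlT : l ∉ hull T) (hx : x ∈ hull T) :
    M.lagrangeFun r l x = 0 := by
  by_contra h
  exact hlT (M.mem_hull_of_hat_eq_zero (lattice_subset_carrier hr hl) fun p hp hpT =>
    hat_eq_zero_of_lagrangeFun_ne_zero hr hl h hp (M.hat_of_notMem hT hx hpT))

/-- Where the product does not vanish, every vertex active at `l` is active at `x`, which forces `x
∈ Ω`. Hence extension by zero preserves continuity, with no regularity assumed of `∂Ω`. -/
theorem lagrangeFun_of_notMem_Ω (hr : 1 ≤ r) {l x : Pt d} (hl : l ∈ M.freedoms r)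
    (hx : x ∈ M.carrier) (hxΩ : x ∉ M.Ω) : M.lagrangeFun r l x = 0 := by
  by_contra h
  exact hxΩ (M.mem_Ω_of_support_subset hl.1 hx fun p hp hp0 =>
    hat_eq_zero_of_lagrangeFun_ne_zero hr hl.2 h hp hp0)

/-- There are `r` factors in total, each with numerator at most `r` and denominator at least one. -/
theorem abs_lagrangeFun_le (hr : 1 ≤ r) {l x : Pt d} (hl : l ∈ M.lattice r) (hx : x ∈ M.carrier) :
    |M.lagrangeFun r l x| ≤ (r : ℝ) ^ r := by
  have h1 : ∀ p ∈ M.vertices, |∏ s ∈ Finset.range (M.nodeIdx r l p),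
      (((r : ℝ) * M.hat p x - s) / ((M.nodeIdx r l p : ℝ) - s))| ≤ (r : ℝ) ^ M.nodeIdx r l p := by
    intro p hp
    rw [Finset.abs_prod]
    conv_rhs => rw [← Finset.card_range (M.nodeIdx r l p), ← Finset.prod_const]
    refine Finset.prod_le_prod (fun _ _ => abs_nonneg _) fun s hs => ?_
    have hs' := Finset.mem_range.1 hs
    have h2 : (s : ℝ) + 1 ≤ M.nodeIdx r l p := by exact_mod_cast hs'
    have h3 : (s : ℝ) ≤ r := by
      have : M.nodeIdx r l p ≤ r := by
        conv_rhs => rw [← sum_nodeIdx hr hl]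
        exact Finset.single_le_sum (f := fun p => M.nodeIdx r l p) (fun _ _ => Nat.zero_le _) hp
      exact_mod_cast hs'.le.trans this
    have h4 := M.hat_nonneg hx p
    have h5 := M.hat_le_one hx p
    have hr0 : (0 : ℝ) ≤ r := by positivity
    have h6 : |(r : ℝ) * M.hat p x - s| ≤ r := by
      rw [abs_le]
      constructor <;> nlinarith [mul_nonneg hr0 h4, Nat.cast_nonneg (α := ℝ) s]
    rw [abs_div, abs_of_pos (by linarith : (0 : ℝ) < (M.nodeIdx r l p : ℝ) - s)]
    exact (div_le_self (abs_nonneg _) (by linarith)).trans h6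
  rw [lagrangeFun, Finset.abs_prod]
  refine (Finset.prod_le_prod (fun _ _ => abs_nonneg _) h1).trans ?_
  rw [Finset.prod_pow_eq_pow_sum, sum_nodeIdx hr hl]

theorem exists_polyFun_eq_lagrangeFun (hr : 1 ≤ r) {l : Pt d} (hl : l ∈ M.lattice r)
    {T : Finset (Pt d)} (hT : T ∈ M.elems) :
    ∃ q : MvPolynomial (Fin d) ℝ, q.totalDegree ≤ r ∧
      ∀ x ∈ hull T, M.lagrangeFun r l x = polyFun q x := by
  choose q hq hqe using fun p => exists_polyFun_eq_affineMap (bary T p)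
  refine ⟨∏ p ∈ M.vertices, ∏ s ∈ Finset.range (M.nodeIdx r l p),
    ((M.nodeIdx r l p : ℝ) - s)⁻¹ • ((r : ℝ) • q p - MvPolynomial.C (s : ℝ)), ?_, fun x hx => ?_⟩
  · refine (MvPolynomial.totalDegree_finsetProd _ _).trans ?_
    conv_rhs => rw [← sum_nodeIdx hr hl]
    refine Finset.sum_le_sum fun p _ => ?_
    refine (MvPolynomial.totalDegree_finsetProd _ _).trans ?_
    have : ∀ s ∈ Finset.range (M.nodeIdx r l p), (((M.nodeIdx r l p : ℝ) - s)⁻¹ •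
        ((r : ℝ) • q p - MvPolynomial.C (s : ℝ))).totalDegree ≤ 1 := fun s _ => by
      refine (MvPolynomial.totalDegree_smul_le _ _).trans
        ((MvPolynomial.totalDegree_sub _ _).trans (max_le ?_
          ((MvPolynomial.totalDegree_C _).trans_le zero_le_one)))
      exact (MvPolynomial.totalDegree_smul_le _ _).trans (hq p)
    refine (Finset.sum_le_card_nsmul _ _ _ this).trans ?_
    simp
  · simp only [lagrangeFun, polyFun, map_prod]
    refine Finset.prod_congr rfl fun p _ => Finset.prod_congr rfl fun s _ => ?_
    rw [M.hat_eq_bary hT hx, hqe, MvPolynomial.smul_eval, map_sub, MvPolynomial.smul_eval,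
      MvPolynomial.eval_C, polyFun, div_eq_inv_mul]

theorem continuousOn_lagrangeFun (l : Pt d) : ContinuousOn (M.lagrangeFun r l) M.carrier := by
  refine continuousOn_finsetProd _ fun p _ => continuousOn_finsetProd _ fun s _ => ?_
  exact ((continuousOn_const.mul (M.continuousOn_hat p)).sub continuousOn_const).div_const _

theorem exists_isNodal (hr : 1 ≤ r) {l : Pt d} (hl : l ∈ M.freedoms r) :
    M.IsNodal r l (M.Ω.indicator (M.lagrangeFun r l)) := by
  have heq : ∀ x ∈ M.carrier, M.Ω.indicator (M.lagrangeFun r l) x = M.lagrangeFun r l x := by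
    intro x hx
    by_cases hxΩ : x ∈ M.Ω
    · rw [Set.indicator_of_mem hxΩ]
    · rw [Set.indicator_of_notMem hxΩ, lagrangeFun_of_notMem_Ω hr hl hx hxΩ]
  have hcl : closure M.Ω ⊆ M.carrier := closure_region_subset _
  refine ⟨⟨?_, fun x hx => Set.indicator_of_notMem hx _, fun T hT => ?_⟩, ?_, fun y hy hne => ?_⟩
  · refine continuous_indicator (fun x hx => ?_) ((continuousOn_lagrangeFun l).mono hcl)
    refine lagrangeFun_of_notMem_Ω hr hl (hcl hx.1) fun h => hx.2 ?_
    rwa [M.isOpen_Ω.interior_eq]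
  · obtain ⟨q, hq, hqe⟩ := exists_polyFun_eq_lagrangeFun hr hl.2 hT
    exact ⟨q, hq, fun x hx => by rw [heq x (M.hull_subset_carrier hT hx), hqe x hx]; rfl⟩
  · rw [Set.indicator_of_mem hl.1, lagrangeFun_self hr hl.2]
  · rw [Set.indicator_of_mem hy.1, lagrangeFun_of_ne hr hl.2 hy.2 hne]

/-- Nodes outside `Ω` carry the value zero by definition of the space, so unisolvence applies on
each element. -/
theorem eq_zero_of_freedoms (hr : 1 ≤ r) {v : Pt d → ℝ} (hv : v ∈ M.Vh r)
    (h0 : ∀ y ∈ M.freedoms r, v y = 0) : v = 0 := by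
  obtain ⟨-, hvΩ, hvp⟩ := hv
  funext x
  by_cases hx : x ∈ M.Ω
  · obtain ⟨T, hT, hxT⟩ := M.mem_carrier.1 (M.Ω_subset_carrier hx)
    obtain ⟨q, hq, hqe⟩ := hvp T hT
    rw [hqe x hxT]
    refine polyFun_eq_zero_of_nodes hr (M.isSimplex hT) hq (fun y hy => ?_) x
    have : v y = polyFun q y := hqe y (nodes_subset_hull hr hy)
    rw [← this]
    by_cases hyΩ : y ∈ M.Ω
    · exact h0 y ⟨hyΩ, T, hT, hy⟩
    · exact hvΩ y hyΩ
  · exact hvΩ x hx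

theorem isNodal_unique (hr : 1 ≤ r) {l : Pt d} {φ ψ : Pt d → ℝ} (hφ : M.IsNodal r l φ)
    (hψ : M.IsNodal r l ψ) : φ = ψ := by
  refine sub_eq_zero.1 (eq_zero_of_freedoms hr ((M.Vh r).sub_mem hφ.1 hψ.1) fun y hy => ?_)
  by_cases h : y = l
  · simp [h, hφ.2.1, hψ.2.1]
  · simp [hφ.2.2 y hy h, hψ.2.2 y hy h]

theorem isNodal_basisFun (hr : 1 ≤ r) {l : Pt d} (hl : l ∈ M.freedoms r) :
    M.IsNodal r l (M.basisFun r l) := by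
  have h : ∃ φ, M.IsNodal r l φ := ⟨_, exists_isNodal hr hl⟩
  rw [basisFun, dif_pos h]
  exact h.choose_spec

theorem basisFun_eq (hr : 1 ≤ r) {l : Pt d} (hl : l ∈ M.freedoms r) :
    M.basisFun r l = M.Ω.indicator (M.lagrangeFun r l) :=
  isNodal_unique hr (isNodal_basisFun hr hl) (exists_isNodal hr hl)

theorem abs_basisFun_le (hr : 1 ≤ r) {l : Pt d} (hl : l ∈ M.freedoms r) (x : Pt d) :
    |M.basisFun r l x| ≤ (r : ℝ) ^ r := by
  rw [basisFun_eq hr hl]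
  by_cases hx : x ∈ M.Ω
  · rw [Set.indicator_of_mem hx]
    exact abs_lagrangeFun_le hr hl.2 (M.Ω_subset_carrier hx)
  · rw [Set.indicator_of_notMem hx, abs_zero]; positivity

theorem basisFun_of_notMem_hull (hr : 1 ≤ r) {l x : Pt d} (hl : l ∈ M.freedoms r)
    {T : Finset (Pt d)} (hT : T ∈ M.elems) (hlT : l ∉ hull T) (hx : x ∈ hull T) :
    M.basisFun r l x = 0 := by
  rw [basisFun_eq hr hl, Set.indicator_apply_eq_zero]
  exact fun _ => lagrangeFun_of_notMem_hull hr hl.2 hT hlT hx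

theorem finite_freedoms : (M.freedoms r).Finite := by
  refine (M.elems.finite_toSet.biUnion fun T hT =>
    (finite_nodes_and_ncard_le r (M.isSimplex hT)).1).subset ?_
  rintro x ⟨-, T, hT, hx⟩
  exact Set.mem_biUnion hT hx

theorem mem_nodes_of_mem_hull (hr : 1 ≤ r) {l : Pt d} (hl : l ∈ M.lattice r) {T : Finset (Pt d)}
    (hT : T ∈ M.elems) (hlT : l ∈ hull T) : l ∈ nodes r T := by
  have hr0 : (r : ℝ) ≠ 0 := by positivity
  refine ⟨M.nodeIdx r l, ?_, ?_⟩
  · have : ∑ p ∈ T, (M.nodeIdx r l p : ℝ) = r := by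
      simp only [nodeIdx_cast hr hl, M.hat_eq_bary hT hlT, ← Finset.mul_sum,
        sum_bary (M.isSimplex hT), mul_one]
    exact_mod_cast this
  · simp only [nodeIdx_cast hr hl, M.hat_eq_bary hT hlT, mul_div_cancel_left₀ _ hr0,
      sum_bary_smul (M.isSimplex hT)]

theorem finiteDimensional_Vh (hr : 1 ≤ r) : FiniteDimensional ℝ (M.Vh r) := by
  have : Finite (M.freedoms r) := finite_freedoms
  let f : M.Vh r →ₗ[ℝ] (M.freedoms r → ℝ) :=
    { toFun := fun v y => v.1 y
      map_add' := fun _ _ => rfl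
      map_smul' := fun _ _ => rfl }
  refine FiniteDimensional.of_injective f ((injective_iff_map_eq_zero f).2 fun v hv => ?_)
  exact Subtype.ext (eq_zero_of_freedoms hr v.2 fun y hy => congrFun hv ⟨y, hy⟩)

theorem finiteDimensional_Vtilde (hr : 1 ≤ r) (S : Finset (Finset (Pt d))) :
    FiniteDimensional ℝ (M.Vtilde r S) := by
  have := finiteDimensional_Vh (M := M) hr
  let f : M.Vh r →ₗ[ℝ] M.Vtilde r S :=
    { toFun := fun v => ⟨(region S).indicator v, v, v.2, rfl⟩
      map_add' := fun u v => Subtype.ext (Set.indicator_add' _ u.1 v.1)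
      map_smul' := fun c v => Subtype.ext (Set.indicator_const_smul _ c v.1) }
  refine Module.Finite.of_surjective f ?_
  rintro ⟨_, v, hv, rfl⟩
  exact ⟨⟨v, hv⟩, rfl⟩

/-! ### Interior degrees of freedom -/

section Dof

variable {S : Finset (Finset (Pt d))}

/-- On an element outside `S` the basis function vanishes in the interior by the support condition,
hence everywhere by continuity; but it equals one at `l`. So the whole star of `l` lies in `S`. -/
theorem mem_of_mem_dof (hr : 1 ≤ r) (hS : S ⊆ M.elems) {l : Pt d} (hl : l ∈ M.dof r S)
    {T : Finset (Pt d)} (hT : T ∈ M.elems) (hlT : l ∈ hull T) : T ∈ S := by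
  by_contra hTS
  have hφ := isNodal_basisFun hr hl.1
  have h0 : ∀ x ∈ interior (hull T), M.basisFun r l x = 0 := by
    intro x hx
    refine image_eq_zero_of_notMem_tsupport fun hxs => ?_
    obtain ⟨T', hT', hxT'⟩ := Set.mem_iUnion₂.1 (closure_region_subset S (hl.2 hxs))
    exact (M.hull_inter_hull_subset_frontier hT (hS hT') (fun h => hTS (h ▸ hT'))
      ⟨interior_subset hx, hxT'⟩).2 hx
  have hcl : hull T ⊆ {x | M.basisFun r l x = 0} := by
    have h1 := (convex_hull T).closure_interior_eq_closure_of_nonempty_interior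
      (interior_hull_nonempty (M.isSimplex hT))
    refine subset_closure.trans (h1 ▸ closure_minimal h0 ?_)
    exact isClosed_eq hφ.1.1 continuous_const
  have : M.basisFun r l l = 0 := hcl hlT
  rw [hφ.2.1] at this
  exact one_ne_zero this

theorem mem_region_of_mem_dof (hr : 1 ≤ r) (hS : S ⊆ M.elems) {l : Pt d} (hl : l ∈ M.dof r S) :
    l ∈ region S := by
  refine mem_interior_iff_mem_nhds.2 ?_
  filter_upwards [M.eventually_mem_star hl.1.1] with z hz
  obtain ⟨T, hT, hlT, hzT⟩ := hz
  exact Set.mem_biUnion (mem_of_mem_dof hr hS hl hT hlT) hzT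

theorem finite_dof : (M.dof r S).Finite := finite_freedoms.subset fun _ h => h.1

theorem mult_le_overlap (hr : 1 ≤ r) {N : ℕ} {S : Fin N → Finset (Finset (Pt d))}
    (hS : ∀ i, S i ⊆ M.elems) {l : Pt d} (hl : l ∈ M.freedoms r) :
    M.mult r S l ≤ M.overlap S := by
  obtain ⟨T, hT, hlT⟩ := hl.2
  refine le_trans (Set.ncard_le_ncard (fun i hi => ?_) (Set.toFinite _))
    (Finset.le_sup (f := fun T => {i | T ∈ S i}.ncard) hT)
  exact mem_of_mem_dof hr (hS i) hi hT (nodes_subset_hull hr hlT)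

theorem one_le_mult {N : ℕ} {S : Fin N → Finset (Finset (Pt d))} {i : Fin N} {l : Pt d}
    (hl : l ∈ M.dof r (S i)) : 1 ≤ M.mult r S l := by
  rw [mult, Nat.one_le_iff_ne_zero]
  exact Set.ncard_ne_zero_of_mem (a := i) hl (Set.toFinite _)

end Dof

end Mesh

/-! ### Integrals of gradients -/

theorem measurable_gradient {d : ℕ} (u : Pt d → ℝ) : Measurable (gradient u) :=
  (InnerProductSpace.toDual ℝ (Pt d)).symm.continuous.measurable.comp (measurable_fderiv ℝ u)

/-- Measurable functions that are differentiable almost everywhere in `ω`, with an essentially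
bounded value and gradient. -/
def Admissible {d : ℕ} (ω : Set (Pt d)) (u : Pt d → ℝ) : Prop :=
  Measurable u ∧ ∃ K, ∀ᵐ x ∂volume.restrict ω,
    DifferentiableAt ℝ u x ∧ ‖gradient u x‖ ≤ K ∧ |u x| ≤ K

section Forms

variable {d : ℕ} {ω : Set (Pt d)} {u v w : Pt d → ℝ}

theorem Admissible.integrable_norm_gradient_sq [IsFiniteMeasure (volume.restrict ω)]
    (hu : Admissible ω u) : IntegrableOn (fun x => ‖gradient u x‖ ^ 2) ω volume := by
  obtain ⟨-, K, hK⟩ := hu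
  refine Integrable.of_bound ((measurable_gradient u).norm.pow_const 2).aestronglyMeasurable
    (K ^ 2) (hK.mono fun x hx => ?_)
  rw [Real.norm_of_nonneg (sq_nonneg _)]
  exact pow_le_pow_left₀ (norm_nonneg _) hx.2.1 2

theorem Admissible.integrable_sq [IsFiniteMeasure (volume.restrict ω)]
    (hu : Admissible ω u) : IntegrableOn (fun x => u x ^ 2) ω volume := by
  obtain ⟨hm, K, hK⟩ := hu
  refine Integrable.of_bound (hm.pow_const 2).aestronglyMeasurable
    (K ^ 2) (hK.mono fun x hx => ?_)
  rw [Real.norm_of_nonneg (sq_nonneg _), ← sq_abs]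
  exact pow_le_pow_left₀ (abs_nonneg _) hx.2.2 2

theorem Admissible.gradient_add (hu : Admissible ω u) (hv : Admissible ω v) :
    ∀ᵐ x ∂volume.restrict ω, gradient (u + v) x = gradient u x + gradient v x := by
  obtain ⟨-, K, hK⟩ := hu
  obtain ⟨-, K', hK'⟩ := hv
  filter_upwards [hK, hK'] with x hx hx'
  rw [gradient, gradient, gradient, fderiv_add hx.1 hx'.1, map_add]

theorem Admissible.gradient_smul (c : ℝ) (hu : Admissible ω u) :
    ∀ᵐ x ∂volume.restrict ω, gradient (c • u) x = c • gradient u x := by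
  obtain ⟨-, K, hK⟩ := hu
  filter_upwards [hK] with x hx
  rw [gradient, gradient, fderiv_const_smul hx.1, map_smul]

variable {A : Pt d → Matrix (Fin d) (Fin d) ℝ} {n : Pt d → ℝ} {amax nmin : ℝ}

theorem Coefficients.mono {Ω : Set (Pt d)} (h : Coefficients Ω A n amax nmin) (hω : ω ⊆ Ω) :
    Coefficients ω A n amax nmin where
  one_le_amax := h.one_le_amax
  nmin_pos := h.nmin_pos
  nmin_le_one := h.nmin_le_one
  measurable_A i j := (h.measurable_A i j).mono_measure (Measure.restrict_mono hω le_rfl)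
  measurable_n := h.measurable_n.mono_measure (Measure.restrict_mono hω le_rfl)
  symm_A := ae_restrict_of_ae_restrict_of_subset hω h.symm_A
  bounds_A := ae_restrict_of_ae_restrict_of_subset hω h.bounds_A
  bounds_n := ae_restrict_of_ae_restrict_of_subset hω h.bounds_n

theorem inner_toEuclideanLin_comm {B : Matrix (Fin d) (Fin d) ℝ} (hB : B.IsSymm) (ξ η : Pt d) :
    inner ℝ (Matrix.toEuclideanLin B ξ) η = inner ℝ (Matrix.toEuclideanLin B η) ξ := by
  have : B.IsHermitian := by
    rwa [Matrix.IsHermitian, Matrix.conjTranspose_eq_transpose_of_trivial]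
  rw [Matrix.isSymmetric_toEuclideanLin_iff.2 this, real_inner_comm]

theorem Coefficients.integrable_formA [IsFiniteMeasure (volume.restrict ω)]
    (h : Coefficients ω A n amax nmin) (hu : Admissible ω u) (hv : Admissible ω v) :
    IntegrableOn (fun x => inner ℝ (Matrix.toEuclideanLin (A x) (gradient u x)) (gradient v x))
      ω volume := by
  have hmeas : AEStronglyMeasurable
      (fun x => inner ℝ (Matrix.toEuclideanLin (A x) (gradient u x)) (gradient v x))
      (volume.restrict ω) := by
    have e : (fun x => inner ℝ (Matrix.toEuclideanLin (A x) (gradient u x)) (gradient v x)) =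
        fun x => ∑ i, (∑ j, A x i j * gradient u x j) * gradient v x i := by
      funext x
      rw [PiLp.inner_apply]
      simp [Matrix.toLpLin_apply, Matrix.mulVec, dotProduct, mul_comm]
    rw [e]
    have hm : ∀ (u : Pt d → ℝ) j, Measurable fun x => gradient u x j := fun u j =>
      (EuclideanSpace.proj j : Pt d →L[ℝ] ℝ).continuous.measurable.comp
        (measurable_gradient u)
    refine AEMeasurable.aestronglyMeasurable ?_
    refine Finset.aemeasurable_fun_sum _ fun i _ => AEMeasurable.mul ?_ (hm v i).aemeasurable
    exact Finset.aemeasurable_fun_sum _ fun j _ => (h.measurable_A i j).mul (hm u j).aemeasurable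
  obtain ⟨-, K, hK⟩ := hu
  obtain ⟨-, K', hK'⟩ := hv
  refine Integrable.of_bound hmeas (amax * (K ^ 2 + K' ^ 2)) ?_
  filter_upwards [hK, hK', h.symm_A, h.bounds_A] with x hx hx' hs hb
  set ξ := gradient u x
  set η := gradient v x
  set B := Matrix.toEuclideanLin (A x)
  -- Positivity at `ξ ± η` bounds the mixed term by the diagonal ones.
  have h1 := (sq_nonneg ‖ξ + η‖).trans (hb (ξ + η)).1
  have h2 := (sq_nonneg ‖ξ - η‖).trans (hb (ξ - η)).1
  have h3 : inner ℝ (B η) ξ = inner ℝ (B ξ) η := inner_toEuclideanLin_comm hs η ξ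
  rw [map_add, inner_add_left, inner_add_right, inner_add_right, h3] at h1
  rw [map_sub, inner_sub_left, inner_sub_right, inner_sub_right, h3] at h2
  have h4 := (hb ξ).2
  have h5 := (hb η).2
  have ha : 0 ≤ amax := zero_le_one.trans h.one_le_amax
  have h6 : amax * ‖ξ‖ ^ 2 ≤ amax * K ^ 2 :=
    mul_le_mul_of_nonneg_left (pow_le_pow_left₀ (norm_nonneg _) hx.2.1 2) ha
  have h7 : amax * ‖η‖ ^ 2 ≤ amax * K' ^ 2 :=
    mul_le_mul_of_nonneg_left (pow_le_pow_left₀ (norm_nonneg _) hx'.2.1 2) ha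
  have h8 := (sq_nonneg ‖ξ‖).trans (hb ξ).1
  have h9 := (sq_nonneg ‖η‖).trans (hb η).1
  rw [Real.norm_eq_abs, abs_le]
  constructor <;> linarith

theorem Coefficients.integrable_formN [IsFiniteMeasure (volume.restrict ω)]
    (h : Coefficients ω A n amax nmin) (hu : Admissible ω u) (hv : Admissible ω v) :
    IntegrableOn (fun x => n x * u x * v x) ω volume := by
  obtain ⟨hum, K, hK⟩ := hu
  obtain ⟨hvm, K', hK'⟩ := hv
  refine Integrable.of_bound ((h.measurable_n.mul hum.aemeasurable).mul
    hvm.aemeasurable).aestronglyMeasurable (1 * K * K') ?_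
  filter_upwards [hK, hK', h.bounds_n] with x hx hx' hb
  have hn : |n x| ≤ 1 := abs_le.2 ⟨by linarith [h.nmin_pos], hb.2⟩
  simp only [norm_mul, Real.norm_eq_abs]
  have hK0 : 0 ≤ K := (abs_nonneg _).trans hx.2.2
  gcongr
  exacts [hx.2.2, hx'.2.2]

theorem formA_add_left [IsFiniteMeasure (volume.restrict ω)]
    (h : Coefficients ω A n amax nmin) (hu : Admissible ω u) (hv : Admissible ω v)
    (hw : Admissible ω w) : formA A ω (u + v) w = formA A ω u w + formA A ω v w := by
  rw [formA, formA, formA, ← integral_add (h.integrable_formA hu hw) (h.integrable_formA hv hw)]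
  refine integral_congr_ae ?_
  filter_upwards [hu.gradient_add hv] with x hx
  rw [hx, map_add, inner_add_left]

theorem formA_smul_left (c : ℝ) (hu : Admissible ω u) :
    formA A ω (c • u) v = c * formA A ω u v := by
  rw [formA, formA, ← integral_const_mul]
  refine integral_congr_ae ?_
  filter_upwards [hu.gradient_smul c] with x hx
  rw [hx, map_smul, inner_smul_left]
  rfl

theorem formA_comm (h : Coefficients ω A n amax nmin) (u v : Pt d → ℝ) :
    formA A ω u v = formA A ω v u := by
  refine integral_congr_ae ?_
  filter_upwards [h.symm_A] with x hx
  exact inner_toEuclideanLin_comm hx _ _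

theorem formN_add_left [IsFiniteMeasure (volume.restrict ω)]
    (h : Coefficients ω A n amax nmin) (hu : Admissible ω u) (hv : Admissible ω v)
    (hw : Admissible ω w) : formN n ω (u + v) w = formN n ω u w + formN n ω v w := by
  rw [formN, formN, formN, ← integral_add (h.integrable_formN hu hw) (h.integrable_formN hv hw)]
  refine integral_congr_ae (Filter.Eventually.of_forall fun x => ?_)
  simp only [Pi.add_apply]; ring

theorem formN_smul_left (c : ℝ) : formN n ω (c • u) v = c * formN n ω u v := by
  rw [formN, formN, ← integral_const_mul]
  refine integral_congr_ae (Filter.Eventually.of_forall fun x => ?_)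
  simp only [Pi.smul_apply, smul_eq_mul]; ring

theorem formN_comm (u v : Pt d → ℝ) : formN n ω u v = formN n ω v u :=
  integral_congr_ae (Filter.Eventually.of_forall fun _ => mul_right_comm _ _ _)

theorem integral_gradient_sq_le_formA [IsFiniteMeasure (volume.restrict ω)]
    (h : Coefficients ω A n amax nmin) (hu : Admissible ω u) :
    ∫ x in ω, ‖gradient u x‖ ^ 2 ≤ formA A ω u u :=
  integral_mono_ae hu.integrable_norm_gradient_sq (h.integrable_formA hu hu)
    (h.bounds_A.mono fun _ hx => (hx _).1)

theorem formA_le_integral_gradient_sq [IsFiniteMeasure (volume.restrict ω)]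
    (h : Coefficients ω A n amax nmin) (hu : Admissible ω u) :
    formA A ω u u ≤ amax * ∫ x in ω, ‖gradient u x‖ ^ 2 := by
  rw [← integral_const_mul]
  exact integral_mono_ae (h.integrable_formA hu hu) (hu.integrable_norm_gradient_sq.const_mul _)
    (h.bounds_A.mono fun _ hx => (hx _).2)

theorem integral_sq_le_formN [IsFiniteMeasure (volume.restrict ω)]
    (h : Coefficients ω A n amax nmin) (hu : Admissible ω u) :
    nmin * ∫ x in ω, u x ^ 2 ≤ formN n ω u u := by
  rw [← integral_const_mul]
  refine integral_mono_ae (hu.integrable_sq.const_mul _) (h.integrable_formN hu hu)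
    (h.bounds_n.mono fun x hx => ?_)
  have := mul_le_mul_of_nonneg_right hx.1 (sq_nonneg (u x))
  simp only
  linarith

theorem formN_le_integral_sq [IsFiniteMeasure (volume.restrict ω)]
    (h : Coefficients ω A n amax nmin) (hu : Admissible ω u) :
    formN n ω u u ≤ ∫ x in ω, u x ^ 2 := by
  refine integral_mono_ae (h.integrable_formN hu hu) hu.integrable_sq
    (h.bounds_n.mono fun x hx => ?_)
  have := mul_le_mul_of_nonneg_right hx.2 (sq_nonneg (u x))
  simp only
  linarith

/-- `formA` as a bilinear form on a space of admissible functions. -/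
noncomputable def bilinA [IsFiniteMeasure (volume.restrict ω)]
    (h : Coefficients ω A n amax nmin) (W : Submodule ℝ (Pt d → ℝ))
    (hW : ∀ u ∈ W, Admissible ω u) : LinearMap.BilinForm ℝ W :=
  LinearMap.mk₂ ℝ (fun u v => formA A ω u v)
    (fun u v w => formA_add_left h (hW _ u.2) (hW _ v.2) (hW _ w.2))
    (fun c u v => formA_smul_left c (hW _ u.2))
    (fun u v w => by
      rw [formA_comm h, formA_comm h u, formA_comm h u]
      exact formA_add_left h (hW _ v.2) (hW _ w.2) (hW _ u.2))
    (fun c u v => by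
      rw [formA_comm h, formA_comm h u]
      exact formA_smul_left c (hW _ v.2))

/-- `formN` as a bilinear form on a space of admissible functions. -/
noncomputable def bilinN [IsFiniteMeasure (volume.restrict ω)]
    (h : Coefficients ω A n amax nmin) (W : Submodule ℝ (Pt d → ℝ))
    (hW : ∀ u ∈ W, Admissible ω u) : LinearMap.BilinForm ℝ W :=
  LinearMap.mk₂ ℝ (fun u v => formN n ω u v)
    (fun u v w => formN_add_left h (hW _ u.2) (hW _ v.2) (hW _ w.2))
    (fun c u v => formN_smul_left c)
    (fun u v w => by
      rw [formN_comm, formN_comm u.1, formN_comm u.1]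
      exact formN_add_left h (hW _ v.2) (hW _ w.2) (hW _ u.2))
    (fun c u v => by
      rw [formN_comm, formN_comm u.1]
      exact formN_smul_left c)

end Forms

/-! ### Finite element functions on elements -/

namespace Mesh

variable {d r : ℕ} {M : Mesh d}

theorem exists_polyFun_eq {v : Pt d → ℝ} (hv : v ∈ M.Vh r) {T : Finset (Pt d)}
    (hT : T ∈ M.elems) :
    ∃ q : MvPolynomial (Fin d) ℝ, q.totalDegree ≤ r ∧ (∀ x ∈ hull T, v x = polyFun q x) ∧
      ∀ x ∈ interior (hull T), DifferentiableAt ℝ v x ∧ gradient v x = gradient (polyFun q) x := by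
  obtain ⟨q, hq, hqe⟩ := hv.2.2 T hT
  refine ⟨q, hq, hqe, fun x hx => ?_⟩
  have hev : v =ᶠ[nhds x] polyFun q := by
    filter_upwards [isOpen_interior.mem_nhds hx] with y hy using hqe y (interior_subset hy)
  exact ⟨hev.differentiableAt_iff.2 (hasGradientAt_polyFun q x).differentiableAt, hev.gradient_eq⟩

theorem continuous_gradient_polyFun (q : MvPolynomial (Fin d) ℝ) :
    Continuous (gradient (polyFun q)) := by
  have : gradient (polyFun q) =
      fun x => WithLp.toLp 2 fun j => polyFun (MvPolynomial.pderiv j q) x :=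
    funext fun x => (hasGradientAt_polyFun q x).gradient
  rw [this]
  exact (PiLp.continuous_toLp 2 _).comp (continuous_pi fun j => continuous_polyFun _)

theorem admissible_of_mem_Vh {v : Pt d → ℝ} (hv : v ∈ M.Vh r) {S : Finset (Finset (Pt d))}
    (hS : S ⊆ M.elems) : Admissible (region S) v := by
  choose! q hq hqe hqi using fun T (hT : T ∈ M.elems) => exists_polyFun_eq hv hT
  have hb : ∀ T, ∃ K, ∀ x ∈ hull T, ‖gradient (polyFun (q T)) x‖ ≤ K ∧ |polyFun (q T) x| ≤ K := by
    intro T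
    obtain ⟨K₁, h1⟩ := (isCompact_hull T).exists_bound_of_continuousOn
      (continuous_gradient_polyFun (q T)).continuousOn
    obtain ⟨K₂, h2⟩ := (isCompact_hull T).exists_bound_of_continuousOn
      (continuous_polyFun (q T)).continuousOn
    exact ⟨max K₁ K₂, fun x hx => ⟨(h1 x hx).trans (le_max_left _ _),
      (h2 x hx).trans (le_max_right _ _)⟩⟩
  choose K hK using hb
  refine ⟨hv.1.measurable, ∑ T ∈ S, |K T|, ae_region fun T hT x hx => ?_⟩
  have hle : K T ≤ ∑ T ∈ S, |K T| :=
    (le_abs_self _).trans (Finset.single_le_sum (f := fun T => |K T|) (fun _ _ => abs_nonneg _) hT)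
  have hxT := interior_subset hx
  obtain ⟨h1, h2⟩ := hqi T (hS hT) x hx
  refine ⟨h1, ?_, ?_⟩
  · rw [h2]; exact (hK T x hxT).1.trans hle
  · rw [hqe T (hS hT) x hxT]; exact (hK T x hxT).2.trans hle

/-- The region is open, so truncation changes neither values nor gradients inside it; the jump at
its boundary never enters the integrals. -/
theorem indicator_eventuallyEq (S : Finset (Finset (Pt d))) (v : Pt d → ℝ) {x : Pt d}
    (hx : x ∈ region S) : (region S).indicator v =ᶠ[nhds x] v := by
  filter_upwards [(isOpen_region S).mem_nhds hx] with y hy using Set.indicator_of_mem hy v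

theorem integral_indicator_sq (S : Finset (Finset (Pt d))) (v : Pt d → ℝ) :
    ∫ x in region S, (region S).indicator v x ^ 2 = ∫ x in region S, v x ^ 2 :=
  setIntegral_congr_fun (isOpen_region S).measurableSet
    fun x hx => by simp only [Set.indicator_of_mem hx]

theorem integral_gradient_indicator_sq (S : Finset (Finset (Pt d))) (v : Pt d → ℝ) :
    ∫ x in region S, ‖gradient ((region S).indicator v) x‖ ^ 2 =
      ∫ x in region S, ‖gradient v x‖ ^ 2 :=
  setIntegral_congr_fun (isOpen_region S).measurableSet
    fun x hx => by simp only [(indicator_eventuallyEq S v hx).gradient_eq]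

theorem admissible_of_mem_Vtilde {v : Pt d → ℝ} {S : Finset (Finset (Pt d))} (hS : S ⊆ M.elems)
    (hv : v ∈ M.Vtilde r S) : Admissible (region S) v := by
  obtain ⟨v, hv, rfl⟩ := hv
  obtain ⟨hm, K, hK⟩ := admissible_of_mem_Vh hv hS
  refine ⟨hm.indicator (isOpen_region S).measurableSet, K, ?_⟩
  filter_upwards [hK, ae_restrict_mem (isOpen_region S).measurableSet] with x hx hxS
  have h := indicator_eventuallyEq S v hxS
  rw [h.gradient_eq, h.eq_of_nhds]
  exact ⟨h.differentiableAt_iff.2 hx.1, hx.2⟩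

theorem exists_sq_mul_volume_le (d r : ℕ) :
    ∃ κ : ℝ, 0 < κ ∧ ∀ (M : Mesh d), ∀ v ∈ M.Vh r, ∀ T ∈ M.elems, ∀ x ∈ hull T,
      v x ^ 2 * volume.real (hull T) ≤ κ * ∫ y in hull T, v y ^ 2 := by
  obtain ⟨κ, hκ, h⟩ := exists_sq_mul_volume_le_integral_sq d r
  refine ⟨κ, hκ, fun M v hv T hT x hx => ?_⟩
  obtain ⟨q, hq, hqe, -⟩ := exists_polyFun_eq hv hT
  have e : ∫ y in hull T, v y ^ 2 = ∫ y in hull T, polyFun q y ^ 2 :=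
    setIntegral_congr_fun (isCompact_hull T).measurableSet fun y hy => by simp only [hqe y hy]
  rw [hqe x hx, e]
  exact h _ (isCompact_hull T) (convex_hull T) q hq x hx

theorem exists_sq_sub_mul_volume_le (d r : ℕ) :
    ∃ κ : ℝ, 0 < κ ∧ ∀ (M : Mesh d), ∀ v ∈ M.Vh r, ∀ T ∈ M.elems, ∀ x ∈ hull T, ∀ y ∈ hull T,
      (v x - v y) ^ 2 * volume.real (hull T) ≤
        κ * Metric.diam (hull T) ^ 2 * ∫ y in hull T, ‖gradient v y‖ ^ 2 := by
  obtain ⟨κ, hκ, h⟩ := exists_sq_sub_mul_volume_le_integral_gradient d r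
  refine ⟨κ, hκ, fun M v hv T hT x hx y hy => ?_⟩
  obtain ⟨q, hq, hqe, hqi⟩ := exists_polyFun_eq hv hT
  have e : ∫ z in hull T, ‖gradient v z‖ ^ 2 = ∫ z in hull T, ‖gradient (polyFun q) z‖ ^ 2 :=
    integral_congr_ae (ae_hull fun z hz => by simp only [(hqi z hz).2])
  rw [hqe x hx, hqe y hy, e]
  exact h _ (isCompact_hull T) (convex_hull T) q hq x hx y hy

theorem integral_hull_sq_le {v : Pt d → ℝ} {T : Finset (Pt d)} {b : ℝ}
    (h : ∀ x ∈ hull T, v x ^ 2 ≤ b) : ∫ x in hull T, v x ^ 2 ≤ b * volume.real (hull T) := by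
  have := norm_setIntegral_le_of_norm_le_const (μ := volume) (s := hull T) (f := fun x => v x ^ 2)
    (C := b) (isCompact_hull T).measure_lt_top
    fun x hx => by rw [Real.norm_of_nonneg (sq_nonneg _)]; exact h x hx
  exact (le_abs_self _).trans this

end Mesh

/-! ### Chains of elements and a Poincaré inequality -/

theorem dist_le_sum_of_chain {X Y : Type*} [PseudoMetricSpace Y] (f : X → Y) (K : ℕ → Set X)
    (b : ℕ → ℝ) (m : ℕ) (hb : ∀ j ≤ m, ∀ x ∈ K j, ∀ y ∈ K j, dist (f x) (f y) ≤ b j)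
    (hK : ∀ j < m, (K j ∩ K (j + 1)).Nonempty) {x y : X} (hx : x ∈ K 0) (hy : y ∈ K m) :
    dist (f x) (f y) ≤ ∑ j ∈ Finset.range (m + 1), b j := by
  induction m generalizing y with
  | zero => simpa using hb 0 le_rfl x hx y hy
  | succ m ih =>
    obtain ⟨p, hp, hp'⟩ := hK m (Nat.lt_succ_self m)
    rw [Finset.sum_range_succ]
    refine (dist_triangle _ (f p) _).trans (add_le_add ?_ (hb _ le_rfl p hp' y hy))
    exact ih (fun j hj => hb j (hj.trans (Nat.le_succ m))) (fun j hj => hK j (hj.trans_le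
      (Nat.le_succ m))) hp

namespace Mesh

variable {d : ℕ} {M : Mesh d} {C : ℝ}

theorem diam_hull_le_h {T : Finset (Pt d)} (hT : T ∈ M.elems) : Metric.diam (hull T) ≤ M.h :=
  Finset.le_sup' (fun T => Metric.diam (hull T)) hT

theorem dist_le_diam_hull {T : Finset (Pt d)} {x y : Pt d} (hx : x ∈ hull T) (hy : y ∈ hull T) :
    dist x y ≤ Metric.diam (hull T) :=
  Metric.dist_le_diam_of_mem (isCompact_hull T).isBounded hx hy

theorem diam_hull_pos (hd : 1 ≤ d) {T : Finset (Pt d)} (hT : T ∈ M.elems) :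
    0 < Metric.diam (hull T) := by
  obtain ⟨p, hp, q, hq, hpq⟩ := Finset.one_lt_card.1 (by rw [M.card_eq T hT]; omega : 1 < T.card)
  exact (dist_pos.2 hpq).trans_le (dist_le_diam_hull (vertex_mem_hull hp) (vertex_mem_hull hq))

theorem h_pos (hd : 1 ≤ d) (M : Mesh d) : 0 < M.h := by
  obtain ⟨T, hT⟩ := M.elems_nonempty
  exact (diam_hull_pos hd hT).trans_le (diam_hull_le_h hT)

/-- A shared edge is at least `C` times the diameter of `T` and no longer than that of `T'`. -/
theorem ShapeRegular.mul_diam_le_diam (h : M.ShapeRegular C) (hC : 0 ≤ C) {T T' : Finset (Pt d)}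
    (hT : T ∈ M.elems) (hTT' : 2 ≤ ((T : Set (Pt d)) ∩ T').ncard) :
    C * Metric.diam (hull T) ≤ Metric.diam (hull T') := by
  obtain ⟨p, q, hp, hq, hpq⟩ := (Set.one_lt_ncard_iff (T.finite_toSet.inter_of_left _)).1 hTT'
  obtain ⟨x, hx⟩ := h T hT
  exact (mul_diam_le_dist_of_closedBall_subset (M.isSimplex hT) hC hx hp.1 hq.1 hpq).trans
    (dist_le_diam_hull (vertex_mem_hull hp.2) (vertex_mem_hull hq.2))

theorem ShapeRegular.le_one (h : M.ShapeRegular C) (hC : 0 ≤ C) (hd : 1 ≤ d) : C ≤ 1 := by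
  obtain ⟨T, hT⟩ := M.elems_nonempty
  have := h.mul_diam_le_diam hC hT (T' := T) (by
    rw [Set.inter_self, Set.ncard_coe_finset, M.card_eq T hT]; omega)
  exact le_of_mul_le_mul_right (this.trans_eq (one_mul _).symm) (diam_hull_pos hd hT)

theorem ShapeRegular.pow_mul_diam_le_of_chain (h : M.ShapeRegular C) (hC : 0 ≤ C)
    {c : ℕ → Finset (Pt d)} {m : ℕ} (hc : ∀ j ≤ m, c j ∈ M.elems)
    (hcc : ∀ j < m, 2 ≤ ((c j : Set (Pt d)) ∩ c (j + 1)).ncard) {i j : ℕ} (hij : i ≤ j)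
    (hj : j ≤ m) : C ^ (j - i) * Metric.diam (hull (c i)) ≤ Metric.diam (hull (c j)) := by
  induction j, hij using Nat.le_induction with
  | base => simp
  | succ j hij ih =>
    have h1 := ih (by omega)
    have h2 := h.mul_diam_le_diam hC (hc j (by omega)) (hcc j (by omega))
    rw [Nat.succ_sub hij, pow_succ', mul_assoc]
    exact (mul_le_mul_of_nonneg_left h1 hC).trans h2

theorem inter_hull_nonempty {T T' : Finset (Pt d)} (h : 2 ≤ ((T : Set (Pt d)) ∩ T').ncard) :
    (hull T ∩ hull T').Nonempty := by
  obtain ⟨p, hp⟩ := Set.nonempty_of_ncard_ne_zero (s := (T : Set (Pt d)) ∩ T') (by omega)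
  exact ⟨p, vertex_mem_hull hp.1, vertex_mem_hull hp.2⟩

/-- The element `T` lies within distance `ρ diam T'` of all points of `T'`. -/
def Near (ρ : ℝ) (T T' : Finset (Pt d)) : Prop :=
  ∀ x ∈ hull T, ∀ y ∈ hull T', dist x y ≤ ρ * Metric.diam (hull T')

/-- Diameters along the chain up to `c j` exceed that of `c j` by at most the factor `C⁻ᴸ`, and
there are at most `L + 1` of them. -/
theorem ShapeRegular.near_of_chain (h : M.ShapeRegular C) (hC : 0 < C) (hd : 1 ≤ d) {L : ℕ}
    {c : ℕ → Finset (Pt d)} {m : ℕ} (hm : m ≤ L) (hc : ∀ j ≤ m, c j ∈ M.elems)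
    (hcc : ∀ j < m, 2 ≤ ((c j : Set (Pt d)) ∩ c (j + 1)).ncard) {j : ℕ} (hj : j ≤ m) :
    Near ((L + 1) / C ^ L) (c 0) (c j) := by
  intro x hx y hy
  have hC1 := h.le_one hC.le hd
  set δ := Metric.diam (hull (c j))
  have hδ : 0 ≤ δ := Metric.diam_nonneg
  have h1 : ∀ i ≤ j, Metric.diam (hull (c i)) ≤ δ / C ^ L := by
    intro i hi
    rw [le_div_iff₀ (pow_pos hC L), mul_comm]
    have h2 := h.pow_mul_diam_le_of_chain hC.le hc hcc hi hj
    have h3 : C ^ L ≤ C ^ (j - i) := pow_le_pow_of_le_one hC.le hC1 (by omega)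
    exact (mul_le_mul_of_nonneg_right h3 Metric.diam_nonneg).trans h2
  have h4 := dist_le_sum_of_chain (fun x : Pt d => x) (fun j => hull (c j)) (fun _ => δ / C ^ L) j
    (fun i hi x hx y hy => (dist_le_diam_hull hx hy).trans (h1 i hi))
    (fun i hi => inter_hull_nonempty (hcc i (by omega))) hx hy
  rw [Finset.sum_const, Finset.card_range, nsmul_eq_mul] at h4
  refine h4.trans ?_
  have h5 : ((j + 1 : ℕ) : ℝ) ≤ L + 1 := by
    have : j + 1 ≤ L + 1 := by omega
    exact_mod_cast this
  calc _ ≤ (L + 1 : ℝ) * (δ / C ^ L) := mul_le_mul_of_nonneg_right h5 (by positivity)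
    _ = _ := by ring

-- All elements near `T'` fit into one ball of radius `ρ diam T'` about the centre of the ball
-- inscribed in `T'`. Their interiors are disjoint, so their volumes add up to at most a fixed
-- multiple of that of the inscribed ball. This replaces a bound on their number.
open Classical in
theorem ShapeRegular.sum_near_volume_le (h : M.ShapeRegular C) (hC : 0 < C)
    {S : Finset (Finset (Pt d))} (hS : S ⊆ M.elems) {ρ : ℝ} (hρ : 0 ≤ ρ) {T' : Finset (Pt d)}
    (hT' : T' ∈ M.elems) :
    ∑ T ∈ S.filter (fun T => Near ρ T T'), volume.real (hull T) ≤
      (2 * ρ / C) ^ d * volume.real (hull T') := by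
  obtain ⟨x, hx⟩ := h T' hT'
  set δ := Metric.diam (hull T')
  have hδ : 0 ≤ δ := Metric.diam_nonneg
  have hvol : ∀ R : ℝ, 0 ≤ R → volume.real (Metric.closedBall x R) =
      R ^ d * volume.real (Metric.ball (0 : Pt d) 1) := by
    intro R hR
    rw [Measure.real, Measure.addHaar_closedBall _ _ hR, ENNReal.toReal_mul,
      finrank_euclideanSpace_fin, ENNReal.toReal_ofReal (by positivity), Measure.real]
  have h1 := M.sum_volume_hull_le (S := S.filter (fun T => Near ρ T T'))
    ((Finset.filter_subset _ _).trans hS) (K := Metric.closedBall x (ρ * δ))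
    (fun T hT y hy => (Finset.mem_filter.1 hT).2 y hy x
      (hx (Metric.mem_closedBall_self (by positivity)))) measure_closedBall_lt_top.ne
  have h2 : volume.real (Metric.closedBall x (C * δ / 2)) ≤ volume.real (hull T') :=
    measureReal_mono hx (isCompact_hull T').measure_lt_top.ne
  rw [hvol _ (by positivity)] at h1 h2
  refine h1.trans ?_
  have h3 : ρ * δ = (2 * ρ / C) * (C * δ / 2) := by field_simp
  rw [h3, mul_pow, mul_assoc]
  exact mul_le_mul_of_nonneg_left h2 (by positivity)

/-- A chain leads from each element to a zero of `v`; the sum of the oscillations along it bounds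
`v` there. Summing over elements, each gradient integral is charged only by nearby elements, whose
total volume is comparable to that of the charged element. -/
theorem exists_integral_sq_le_integral_gradient_sq (d r : ℕ) (hd : 1 ≤ d) (hr : 1 ≤ r) {C : ℝ}
    (hC : 0 < C) (L : ℕ) :
    ∃ κ : ℝ, 0 < κ ∧ ∀ M : Mesh d, M.ShapeRegular C → ∀ S ⊆ M.elems, M.NotThin r S L →
      ∀ v ∈ M.Vh r, (∀ l ∈ M.dof r S, v l = 0) →
        ∫ x in region S, v x ^ 2 ≤ κ * M.h ^ 2 * ∫ x in region S, ‖gradient v x‖ ^ 2 := by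
  classical
  obtain ⟨κ, hκ, hosc⟩ := exists_sq_sub_mul_volume_le d r
  set ρ : ℝ := (L + 1) / C ^ L
  have hρ : 0 < ρ := by positivity
  -- One factor `L + 1` comes from Cauchy-Schwarz along the chain, the other from its number of
  -- terms; the power is the volume ratio of near elements.
  refine ⟨(L + 1) * (L + 1) * κ * (2 * ρ / C) ^ d, by positivity, ?_⟩
  intro M hM S hS hthin v hv hdof
  set G : Finset (Pt d) → ℝ := fun T => ∫ x in hull T, ‖gradient v x‖ ^ 2
  have hG : ∀ T, 0 ≤ G T := fun T => integral_nonneg fun x => sq_nonneg _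
  set g : Finset (Pt d) → ℝ := fun T => G T / volume.real (hull T)
  have hg : ∀ T, 0 ≤ g T := fun T => div_nonneg (hG T) measureReal_nonneg
  have hh : 0 ≤ M.h := (h_pos hd M).le
  have hlocal : ∀ T ∈ S, ∫ x in hull T, v x ^ 2 ≤
      (L + 1) * (L + 1) * κ * M.h ^ 2 *
        ∑ T' ∈ S, if Near ρ T T' then g T' * volume.real (hull T) else 0 := by
    intro T hT
    obtain ⟨m, hm, c, rfl, hcS, hcc, y, hy, hy0⟩ := hthin T hT
    have hc : ∀ j ≤ m, c j ∈ M.elems := fun j hj => hS (hcS j hj)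
    have hvy : v y = 0 := by
      rcases hy0 with h | h
      · exact hdof y h
      · refine hv.2.1 y fun hyΩ => h.2 ?_
        rwa [M.isOpen_Ω.interior_eq]
    set b : ℕ → ℝ := fun j => Real.sqrt (κ * M.h ^ 2 * g (c j))
    have hb : ∀ j ≤ m, ∀ x ∈ hull (c j), ∀ y ∈ hull (c j), dist (v x) (v y) ≤ b j := by
      intro j hj x hx y hy
      rw [Real.dist_eq]
      refine Real.le_sqrt_of_sq_le ?_
      have h1 := hosc M v hv (c j) (hc j hj) x hx y hy
      have hvol := volume_hull_pos (M.isSimplex (hc j hj))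
      rw [sq_abs]
      simp only [g]
      rw [mul_div_assoc', le_div_iff₀ hvol]
      refine h1.trans (mul_le_mul_of_nonneg_right ?_ (hG _))
      exact mul_le_mul_of_nonneg_left
        (pow_le_pow_left₀ Metric.diam_nonneg (diam_hull_le_h (hc j hj)) 2) hκ.le
    -- Replacing the chain by all elements near `T` removes the dependence on its choice and
    -- prepares the exchange of the sums.
    set N := ∑ T' ∈ S, if Near ρ (c 0) T' then g T' else 0
    have hgN : ∀ j ≤ m, g (c j) ≤ N := by
      intro j hj
      have h1 : Near ρ (c 0) (c j) := hM.near_of_chain hC hd hm hc hcc hj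
      have h2 := Finset.single_le_sum (f := fun T' => if Near ρ (c 0) T' then g T' else 0)
        (fun T' _ => by split_ifs; exacts [hg T', le_rfl]) (hcS j hj)
      rwa [if_pos h1] at h2
    have hmL : ((m + 1 : ℕ) : ℝ) ≤ L + 1 := by
      have : m + 1 ≤ L + 1 := by omega
      exact_mod_cast this
    have hN : 0 ≤ N := (hg _).trans (hgN 0 (Nat.zero_le _))
    have hsup : ∀ x ∈ hull (c 0), v x ^ 2 ≤ (L + 1) * (L + 1) * κ * M.h ^ 2 * N := by
      intro x hx
      have h1 := dist_le_sum_of_chain v (fun j => hull (c j)) b m hb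
        (fun j hj => inter_hull_nonempty (hcc j hj)) hx (nodes_subset_hull hr hy)
      rw [hvy, dist_zero_right, Real.norm_eq_abs] at h1
      calc v x ^ 2 = |v x| ^ 2 := (sq_abs _).symm
        _ ≤ (∑ j ∈ Finset.range (m + 1), b j) ^ 2 := pow_le_pow_left₀ (abs_nonneg _) h1 2
        _ ≤ ((Finset.range (m + 1)).card : ℝ) * ∑ j ∈ Finset.range (m + 1), b j ^ 2 :=
          sq_sum_le_card_mul_sum_sq
        _ ≤ (L + 1) * ∑ j ∈ Finset.range (m + 1), κ * M.h ^ 2 * N := by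
          rw [Finset.card_range]
          refine mul_le_mul hmL (Finset.sum_le_sum fun j hj => ?_)
            (Finset.sum_nonneg fun _ _ => sq_nonneg _) (by positivity)
          rw [Real.sq_sqrt (mul_nonneg (by positivity) (hg _))]
          exact mul_le_mul_of_nonneg_left
            (hgN j (Nat.lt_succ_iff.1 (Finset.mem_range.1 hj))) (by positivity)
        _ = ((m + 1 : ℕ) : ℝ) * ((L + 1) * κ * M.h ^ 2 * N) := by
          rw [Finset.sum_const, Finset.card_range, nsmul_eq_mul]; ring
        _ ≤ (L + 1) * ((L + 1) * κ * M.h ^ 2 * N) :=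
          mul_le_mul_of_nonneg_right hmL (by positivity)
        _ = _ := by ring
    refine (integral_hull_sq_le hsup).trans_eq ?_
    rw [mul_assoc, Finset.sum_mul]
    congr 1
    exact Finset.sum_congr rfl fun T' _ => by rw [ite_mul, zero_mul]
  have hadm := admissible_of_mem_Vh hv hS
  rw [M.setIntegral_region hS hadm.integrable_sq,
    M.setIntegral_region hS hadm.integrable_norm_gradient_sq]
  refine (Finset.sum_le_sum hlocal).trans ?_
  rw [← Finset.mul_sum, Finset.sum_comm]
  have hin : ∀ T' ∈ S, (∑ T ∈ S, if Near ρ T T' then g T' * volume.real (hull T) else 0) ≤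
      (2 * ρ / C) ^ d * G T' := by
    intro T' hT'
    rw [← Finset.sum_filter, ← Finset.mul_sum]
    have h1 := mul_le_mul_of_nonneg_left (hM.sum_near_volume_le hC hS hρ.le (hS hT')) (hg T')
    refine h1.trans_eq ?_
    have := volume_hull_pos (M.isSimplex (hS hT'))
    simp only [g]
    field_simp
  refine (mul_le_mul_of_nonneg_left (Finset.sum_le_sum hin) (by positivity)).trans_eq ?_
  rw [← Finset.mul_sum]
  ring

end Mesh

namespace Mesh

/-! ### Nodal sums over the interior degrees of freedom -/

section NodalSum

variable {d r : ℕ} {M : Mesh d} {S : Finset (Finset (Pt d))}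

variable (M r S) in
/-- The function of `V^h` with the nodal values `c` at the interior degrees of freedom of `S` and
`0` at all other nodes. -/
noncomputable def nodalSum (c : Pt d → ℝ) : Pt d → ℝ :=
  ∑ l ∈ (finite_dof (M := M) (r := r) (S := S)).toFinset, c l • M.basisFun r l

theorem nodalSum_mem_Vh (hr : 1 ≤ r) (c : Pt d → ℝ) : M.nodalSum r S c ∈ M.Vh r :=
  (M.Vh r).sum_mem fun _ hl => (M.Vh r).smul_mem _
    (isNodal_basisFun hr ((Set.Finite.mem_toFinset _).1 hl).1).1

theorem nodalSum_apply (c : Pt d → ℝ) (x : Pt d) : M.nodalSum r S c x =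
    ∑ l ∈ (finite_dof (M := M) (r := r) (S := S)).toFinset, c l * M.basisFun r l x := by
  simp [nodalSum]

theorem nodalSum_apply_dof (hr : 1 ≤ r) (c : Pt d → ℝ) {l : Pt d} (hl : l ∈ M.dof r S) :
    M.nodalSum r S c l = c l := by
  rw [nodalSum_apply, Finset.sum_eq_single l]
  · rw [(isNodal_basisFun hr hl.1).2.1, mul_one]
  · intro l' hl' hne
    rw [(isNodal_basisFun hr ((Set.Finite.mem_toFinset _).1 hl').1).2.2 l hl.1 hne.symm, mul_zero]
  · exact fun h => (h ((Set.Finite.mem_toFinset _).2 hl)).elim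

theorem nodalSum_add (c c' : Pt d → ℝ) :
    M.nodalSum r S (c + c') = M.nodalSum r S c + M.nodalSum r S c' := by
  simp [nodalSum, add_smul, Finset.sum_add_distrib]

theorem nodalSum_smul (a : ℝ) (c : Pt d → ℝ) :
    M.nodalSum r S (a • c) = a • M.nodalSum r S c := by
  simp [nodalSum, mul_smul, Finset.smul_sum]

theorem abs_nodalSum_le (hr : 1 ≤ r) (c : Pt d → ℝ) {T : Finset (Pt d)} (hT : T ∈ M.elems)
    {b : ℝ} (hc : ∀ l ∈ M.dof r S, l ∈ hull T → |c l| ≤ b) {x : Pt d} (hx : x ∈ hull T)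
    (hb : 0 ≤ b) : |M.nodalSum r S c x| ≤ (r + 1) ^ (d + 1) * r ^ r * b := by
  classical
  have hfin := finite_nodes_and_ncard_le r (M.isSimplex hT)
  rw [nodalSum_apply, ← Finset.sum_filter_of_ne (p := fun l => l ∈ hull T) fun l hl hne => by
    by_contra hlT
    refine hne ?_
    rw [basisFun_of_notMem_hull hr ((Set.Finite.mem_toFinset _).1 hl).1 hT hlT hx, mul_zero]]
  set F := (finite_dof (M := M) (r := r) (S := S)).toFinset.filter fun l => l ∈ hull T
  have hF : ∀ l ∈ F, l ∈ M.dof r S ∧ l ∈ hull T := fun l hl =>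
    ⟨(Set.Finite.mem_toFinset _).1 (Finset.mem_filter.1 hl).1, (Finset.mem_filter.1 hl).2⟩
  have hcard : (F.card : ℝ) ≤ (r + 1) ^ (d + 1) := by
    have : F.card ≤ (r + 1) ^ (d + 1) := by
      rw [← Set.ncard_coe_finset]
      exact (Set.ncard_le_ncard (fun l hl => mem_nodes_of_mem_hull hr (hF l hl).1.1.2 hT
        (hF l hl).2) hfin.1).trans hfin.2
    exact_mod_cast this
  calc _ ≤ ∑ l ∈ F, |c l * M.basisFun r l x| := Finset.abs_sum_le_sum_abs _ _
    _ ≤ ∑ l ∈ F, b * (r : ℝ) ^ r := Finset.sum_le_sum fun l hl => by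
        rw [abs_mul]
        exact mul_le_mul (hc l (hF l hl).1 (hF l hl).2) (abs_basisFun_le hr (hF l hl).1.1 x)
          (abs_nonneg _) hb
    _ = F.card * (r ^ r * b) := by rw [Finset.sum_const, nsmul_eq_mul]; ring
    _ ≤ _ := by
        rw [mul_assoc]
        exact mul_le_mul_of_nonneg_right hcard (by positivity)

/-- On one element, nodal values of the second function are bounded by its mean square, and the
first function is a bounded number of basis functions, each at most `r ^ r`, with coefficients
larger by at most `Λ`. No shape regularity enters. -/
theorem exists_integral_nodalSum_sq_le (d r : ℕ) (hr : 1 ≤ r) :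
    ∃ κ : ℝ, 0 < κ ∧ ∀ (M : Mesh d) (S : Finset (Finset (Pt d))) (c c' : Pt d → ℝ) (Λ : ℝ), 0 ≤ Λ →
      (∀ l ∈ M.dof r S, |c l| ≤ Λ * |c' l|) → ∀ T ∈ M.elems,
      ∫ x in hull T, M.nodalSum r S c x ^ 2 ≤
        κ * Λ ^ 2 * ∫ x in hull T, M.nodalSum r S c' x ^ 2 := by
  obtain ⟨κ, hκ, hsup⟩ := exists_sq_mul_volume_le d r
  have hr0 : (0 : ℝ) < r := by exact_mod_cast hr
  set B : ℝ := (r + 1) ^ (d + 1) * r ^ r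
  have hB : 0 < B := by positivity
  refine ⟨B ^ 2 * κ, by positivity, fun M S c c' Λ hΛ hcc T hT => ?_⟩
  set I := ∫ x in hull T, M.nodalSum r S c' x ^ 2
  have hI : 0 ≤ I := integral_nonneg fun _ => sq_nonneg _
  have hvol := volume_hull_pos (M.isSimplex hT)
  set b := Real.sqrt (κ * I / volume.real (hull T))
  have hc' : ∀ l ∈ M.dof r S, l ∈ hull T → |c l| ≤ Λ * b := fun l hl hlT => by
    refine (hcc l hl).trans (mul_le_mul_of_nonneg_left (Real.le_sqrt_of_sq_le ?_) hΛ)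
    rw [sq_abs, le_div_iff₀ hvol, ← nodalSum_apply_dof hr c' hl]
    exact hsup M _ (nodalSum_mem_Vh hr c') T hT l hlT
  have hb0 : 0 ≤ b := Real.sqrt_nonneg _
  have h1 : ∀ x ∈ hull T, M.nodalSum r S c x ^ 2 ≤ (B * (Λ * b)) ^ 2 := fun x hx => by
    rw [← sq_abs]
    exact pow_le_pow_left₀ (abs_nonneg _) (abs_nodalSum_le hr c hT hc' hx (by positivity)) 2
  refine (integral_hull_sq_le h1).trans_eq ?_
  have h2 : b ^ 2 * volume.real (hull T) = κ * I := by
    rw [Real.sq_sqrt (by positivity)]; field_simp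
  calc _ = B ^ 2 * Λ ^ 2 * (b ^ 2 * volume.real (hull T)) := by ring
    _ = _ := by rw [h2]; ring

theorem Xi_eq {N : ℕ} (S : Fin N → Finset (Finset (Pt d))) (i : Fin N) (v : Pt d → ℝ) :
    M.Xi r S i v = (region (S i)).indicator
      (M.nodalSum r (S i) fun l => (M.mult r S l : ℝ)⁻¹ * v l) := by
  funext x
  rw [Xi, finsum_mem_eq_finite_toFinset_sum _ (finite_dof (M := M) (r := r) (S := S i))]
  by_cases hx : x ∈ region (S i)
  · simp only [Set.indicator_of_mem hx, nodalSum_apply]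
  · simp only [Set.indicator_of_notMem hx, mul_zero, Finset.sum_const_zero]

theorem Xi_mem_Vtilde (hr : 1 ≤ r) {N : ℕ} (S : Fin N → Finset (Finset (Pt d))) (i : Fin N)
    (v : Pt d → ℝ) : M.Xi r S i v ∈ M.Vtilde r (S i) :=
  ⟨_, nodalSum_mem_Vh hr _, Xi_eq S i v⟩

/-- The partition of unity operator as a linear map of the local space. -/
noncomputable def XiLin (M : Mesh d) (hr : 1 ≤ r) {N : ℕ} (S : Fin N → Finset (Finset (Pt d)))
    (i : Fin N) : M.Vtilde r (S i) →ₗ[ℝ] M.Vtilde r (S i) where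
  toFun v := ⟨M.Xi r S i v, Xi_mem_Vtilde hr S i v⟩
  map_add' u v := by
    refine Subtype.ext ?_
    simp only [Submodule.coe_add, Xi_eq]
    rw [← Set.indicator_add', ← nodalSum_add]
    congr 2
    funext l
    simp [mul_add]
  map_smul' a v := by
    refine Subtype.ext ?_
    simp only [Submodule.coe_smul, Xi_eq, RingHom.id_apply]
    rw [show ∀ f : Pt d → ℝ, a • (region (S i)).indicator f = (region (S i)).indicator (a • f) from
      fun f => (Set.indicator_const_smul _ a f).symm, ← nodalSum_smul]
    congr 2
    funext l
    simp only [Pi.smul_apply, smul_eq_mul]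
    ring

end NodalSum

/-! ### The local forms -/

section Local

variable {d r : ℕ} {M : Mesh d} {S : Finset (Finset (Pt d))}
  {A : Pt d → Matrix (Fin d) (Fin d) ℝ} {n : Pt d → ℝ} {amax nmin k Cinv : ℝ}

/-- The inverse estimate, summed over the elements, trades the gradient for `k` times the L² norm.
-/
theorem inner1k_nodalSum_le (hr : 1 ≤ r) (hS : S ⊆ M.elems)
    (h : Coefficients (region S) A n amax nmin) (hinv : M.InverseEstimate r k Cinv)
    (c : Pt d → ℝ) :
    inner1k A n k (region S) ((region S).indicator (M.nodalSum r S c))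
        ((region S).indicator (M.nodalSum r S c)) ≤
      (amax * Cinv ^ 2 + 1) * k ^ 2 * ∑ T ∈ S, ∫ x in hull T, M.nodalSum r S c x ^ 2 := by
  set w := M.nodalSum r S c
  have hw : w ∈ M.Vh r := nodalSum_mem_Vh hr c
  have hadm := admissible_of_mem_Vh hw hS
  have hadm' : Admissible (region S) ((region S).indicator w) :=
    admissible_of_mem_Vtilde (r := r) hS ⟨w, hw, rfl⟩
  have h1 := formA_le_integral_gradient_sq h hadm'
  have h2 := formN_le_integral_sq h hadm'
  rw [integral_gradient_indicator_sq, M.setIntegral_region hS hadm.integrable_norm_gradient_sq]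
    at h1
  rw [integral_indicator_sq, M.setIntegral_region hS hadm.integrable_sq] at h2
  have h3 : ∑ T ∈ S, ∫ x in hull T, ‖gradient w x‖ ^ 2 ≤
      (Cinv * k) ^ 2 * ∑ T ∈ S, ∫ x in hull T, w x ^ 2 := by
    rw [Finset.mul_sum]
    refine Finset.sum_le_sum fun T hT => ?_
    have h4 : Real.sqrt (∫ x in hull T, ‖gradient w x‖ ^ 2) ^ 2 ≤
        (Cinv * k * Real.sqrt (∫ x in hull T, w x ^ 2)) ^ 2 :=
      pow_le_pow_left₀ (Real.sqrt_nonneg _) (hinv T (hS hT) w hw) 2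
    rw [mul_pow, Real.sq_sqrt (integral_nonneg fun _ => sq_nonneg _),
      Real.sq_sqrt (integral_nonneg fun _ => sq_nonneg _)] at h4
    exact h4
  have h5 := mul_le_mul_of_nonneg_left h3 (zero_le_one.trans h.one_le_amax)
  have h6 := mul_le_mul_of_nonneg_left h2 (sq_nonneg k)
  rw [inner1k]
  calc _ ≤ amax * ((Cinv * k) ^ 2 * ∑ T ∈ S, ∫ x in hull T, w x ^ 2) +
        k ^ 2 * ∑ T ∈ S, ∫ x in hull T, w x ^ 2 := add_le_add (h1.trans h5) h6
    _ = _ := by ring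

theorem Vtilde_eq_zero_of_integral_sq {v : Pt d → ℝ} (hv : v ∈ M.Vtilde r S)
    (h0 : ∫ x in region S, v x ^ 2 ≤ 0) (hS : S ⊆ M.elems) : v = 0 := by
  obtain ⟨v, hv, rfl⟩ := hv
  rw [integral_indicator_sq] at h0
  have hadm := admissible_of_mem_Vh hv hS
  have h1 := (setIntegral_eq_zero_iff_of_nonneg_ae
    (Filter.Eventually.of_forall fun x => sq_nonneg (v x)) hadm.integrable_sq).1
    (le_antisymm h0 (integral_nonneg fun _ => sq_nonneg _))
  have h2 := Measure.eqOn_open_of_ae_eq h1 (isOpen_region S) (hv.1.pow 2).continuousOn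
    continuousOn_const
  funext x
  rw [Pi.zero_apply, Set.indicator_apply_eq_zero]
  exact fun hx => pow_eq_zero_iff two_ne_zero |>.1 (h2 hx)

/-- The Poincaré inequality and the smallness of `h k` bound the `k ^ 2` term by a quarter of the
squared gradient norm, which the `A` term dominates. -/
theorem exists_coercivity (d r : ℕ) (hd : 1 ≤ d) (hr : 1 ≤ r) {C : ℝ} (hC : 0 < C) (L : ℕ) :
    ∃ C₁ : ℝ, 0 < C₁ ∧ ∀ M : Mesh d, M.ShapeRegular C → ∀ S ⊆ M.elems, M.NotThin r S L →
      ∀ (A : Pt d → Matrix (Fin d) (Fin d) ℝ) (n : Pt d → ℝ) (amax nmin k : ℝ),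
      Coefficients (region S) A n amax nmin → (M.h * k) ^ 2 ≤ C₁ →
      ∀ v ∈ M.Vtilde r S, (∀ l ∈ M.dof r S, v l = 0) →
        C₁ * (M.h ^ 2)⁻¹ * ∫ x in region S, v x ^ 2 ≤ formB A n k (region S) v v ∧
        inner1k A n k (region S) v v ≤ 2 * formB A n k (region S) v v := by
  obtain ⟨κ, hκ, hP⟩ := exists_integral_sq_le_integral_gradient_sq d r hd hr hC L
  -- With this one value, the `k ^ 2` term and the left side of the lower bound are each at most a
  -- quarter of the gradient integral.
  refine ⟨(4 * κ)⁻¹, by positivity, fun M hM S hS hthin A n amax nmin k hco hhk v hv hdof => ?_⟩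
  have hadm := admissible_of_mem_Vtilde hS hv
  have hP' : ∫ x in region S, v x ^ 2 ≤ κ * M.h ^ 2 * ∫ x in region S, ‖gradient v x‖ ^ 2 := by
    obtain ⟨v, hv, rfl⟩ := hv
    rw [integral_indicator_sq, integral_gradient_indicator_sq]
    refine hP M hM S hS hthin v hv fun l hl => ?_
    have := hdof l hl
    rwa [Set.indicator_of_mem (mem_region_of_mem_dof hr hS hl)] at this
  have hh := h_pos hd M
  set I := ∫ x in region S, v x ^ 2
  set G := ∫ x in region S, ‖gradient v x‖ ^ 2
  have hA : G ≤ formA A (region S) v v := integral_gradient_sq_le_formA hco hadm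
  have hN : formN n (region S) v v ≤ I := formN_le_integral_sq hco hadm
  have hG : 0 ≤ G := integral_nonneg fun _ => sq_nonneg _
  have h1 : k ^ 2 * formN n (region S) v v ≤ 1 / 4 * G := by
    have h2 : k ^ 2 * I ≤ k ^ 2 * (κ * M.h ^ 2 * G) := mul_le_mul_of_nonneg_left hP' (sq_nonneg k)
    have h3 : (M.h * k) ^ 2 * (κ * G) ≤ (4 * κ)⁻¹ * (κ * G) :=
      mul_le_mul_of_nonneg_right hhk (by positivity)
    have h4 : (4 * κ)⁻¹ * (κ * G) = 1 / 4 * G := by field_simp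
    have h5 := mul_le_mul_of_nonneg_left hN (sq_nonneg k)
    nlinarith
  have h6 : (4 * κ)⁻¹ * (M.h ^ 2)⁻¹ * I ≤ 1 / 4 * G := by
    have h7 := mul_le_mul_of_nonneg_left hP' (by positivity : 0 ≤ (4 * κ)⁻¹ * (M.h ^ 2)⁻¹)
    refine h7.trans_eq ?_
    field_simp
  rw [formB, inner1k]
  constructor <;> linarith


end Local

end Mesh

end HkGenEO

/-! ### The lower bound for the smallest eigenvalue. -/

open HkGenEO HkGenEO.Mesh

theorem theorem3p7 (d r : ℕ) (hd : 2 ≤ d) (hr : 1 ≤ r) (Csr : ℝ) (hCsr : 0 < Csr) :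
    ∃ C : ℝ, 0 < C ∧ ∀ L : ℕ, ∃ C₁ : ℝ, 0 < C₁ ∧
      ∀ (M : HkGenEO.Mesh d), M.ShapeRegular Csr →
      ∀ (A : EuclideanSpace ℝ (Fin d) → Matrix (Fin d) (Fin d) ℝ)
        (n : EuclideanSpace ℝ (Fin d) → ℝ) (amax nmin : ℝ),
        HkGenEO.Coefficients M.Ω A n amax nmin →
      ∀ (k Cinv : ℝ), 0 < k → 1 ≤ Cinv → M.InverseEstimate r k Cinv →
      ∀ (N : ℕ) (S : Fin N → Finset (Finset (EuclideanSpace ℝ (Fin d)))),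
        (∀ i, S i ⊆ M.elems) → (⋃ i, HkGenEO.region (S i)) = M.Ω →
        (M.h * k) ^ 2 ≤ C₁ →
      ∀ i : Fin N, M.NotThin r (S i) L →
        (∀ v ∈ M.kerC r A n k S i,
          C₁ * (M.h ^ 2)⁻¹ * HkGenEO.l2norm (HkGenEO.region (S i)) v ^ 2 ≤
            HkGenEO.Mesh.localB A n k S i v v) ∧
        ((∃ v ∈ M.Vtilde r (S i), v ∉ M.kerC r A n k S i) →
          ∃ lam₁ : ℝ, IsLeast (M.eigenvalues r A n k S i) lam₁ ∧
            -(C * M.Ceig S amax nmin Cinv) ≤ lam₁) := by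
  obtain ⟨κ, hκ, hstab⟩ := exists_integral_nodalSum_sq_le d r hr
  -- The 3 is that of `-3 * e w w ≤ B p p`; `κ` compares nodal sums element by element and so can be
  -- fixed before `L`.
  refine ⟨3 * κ, by positivity, fun L => ?_⟩
  obtain ⟨C₁, hC₁, hcoer⟩ := exists_coercivity d r (by omega) hr hCsr L
  refine ⟨C₁, hC₁, ?_⟩
  intro M hM A n amax nmin hco k Cinv hk hCinv hinv N S hS _ hhk i hthin
  have hcoR : Coefficients (region (S i)) A n amax nmin := hco.mono (region_mono (hS i))
  have hcoer := hcoer M hM (S i) (hS i) hthin A n amax nmin k hcoR hhk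
  have hn0 := hco.nmin_pos
  have hVadm : ∀ u ∈ M.Vtilde r (S i), Admissible (region (S i)) u := fun u hu =>
    admissible_of_mem_Vtilde (hS i) hu
  have hE : ∀ u ∈ M.Vtilde r (S i), k ^ 2 * nmin * ∫ x in region (S i), u x ^ 2 ≤
      inner1k A n k (region (S i)) u u := by
    intro u hu
    have h1 := integral_gradient_sq_le_formA hcoR (hVadm u hu)
    have h2 := integral_sq_le_formN hcoR (hVadm u hu)
    have h3 : 0 ≤ ∫ x in region (S i), ‖gradient u x‖ ^ 2 := integral_nonneg fun _ => sq_nonneg _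
    have h4 := mul_le_mul_of_nonneg_left h2 (sq_nonneg k)
    rw [inner1k]
    linarith
  have hE0 : ∀ u ∈ M.Vtilde r (S i), 0 ≤ inner1k A n k (region (S i)) u u := fun u hu =>
    (mul_nonneg (by positivity) (integral_nonneg fun _ => sq_nonneg _)).trans (hE u hu)
  -- A zero energy forces `Xi v = 0`, whose value at an interior node is the value of `v` divided by
  -- a nonzero multiplicity.
  have hdofker : ∀ v ∈ M.Vtilde r (S i), M.localC r A n k S i v v = 0 →
      ∀ l ∈ M.dof r (S i), v l = 0 := by
    intro v hv h0 l hl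
    have h1 := hE _ (Xi_mem_Vtilde hr S i v)
    have h2 : inner1k A n k (region (S i)) (M.Xi r S i v) (M.Xi r S i v) = 0 := h0
    rw [h2] at h1
    have h3 := Vtilde_eq_zero_of_integral_sq (Xi_mem_Vtilde hr S i v)
      (nonpos_of_mul_nonpos_right h1 (by positivity)) (hS i)
    have h4 := congrFun h3 l
    rw [Xi_eq, Set.indicator_of_mem (mem_region_of_mem_dof hr (hS i) hl),
      nodalSum_apply_dof hr _ hl] at h4
    have h5 : (M.mult r S l : ℝ) ≠ 0 := by
      have := one_le_mult hl
      positivity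
    exact (mul_eq_zero.1 h4).resolve_left (inv_ne_zero h5)
  refine ⟨fun v hv => ?_, fun ⟨v₀, hv₀, hv₀k⟩ => ?_⟩
  · rw [l2norm, Real.sq_sqrt (integral_nonneg fun _ => sq_nonneg _)]
    exact (hcoer v hv.1 (hdofker v hv.1 (hv.2 v hv.1))).1
  have := finiteDimensional_Vtilde (M := M) hr (S i)
  set W := M.Vtilde r (S i)
  set a := bilinA hcoR W hVadm
  set m := bilinN hcoR W hVadm
  set B : LinearMap.BilinForm ℝ W := a - k ^ 2 • m
  set e : LinearMap.BilinForm ℝ W := a + k ^ 2 • m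
  set C : LinearMap.BilinForm ℝ W := e.compl₁₂ (M.XiLin hr S i) (M.XiLin hr S i)
  have has : ∀ u v : W, a u v = a v u := fun u v => formA_comm hcoR _ _
  have hms : ∀ u v : W, m u v = m v u := fun u v => formN_comm _ _
  have ha0 : ∀ u : W, 0 ≤ a u u := fun u =>
    (integral_nonneg fun _ => sq_nonneg _).trans
      (integral_gradient_sq_le_formA hcoR (hVadm u u.2))
  have hm0 : ∀ u : W, 0 ≤ m u u := fun u =>
    (mul_nonneg hn0.le (integral_nonneg fun _ => sq_nonneg _)).trans
      (integral_sq_le_formN hcoR (hVadm u u.2))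
  have hBa : ∀ u v : W, B u v = a u v - k ^ 2 * m u v := fun u v => rfl
  have hea : ∀ u v : W, e u v = a u v + k ^ 2 * m u v := fun u v => rfl
  have hBs : ∀ u v : W, B u v = B v u := fun u v => by rw [hBa, hBa, has, hms]
  have hes : ∀ u v : W, e u v = e v u := fun u v => by rw [hea, hea, has, hms]
  have hCs : ∀ u v : W, C u v = C v u := fun u v => hes _ _
  have hC0 : ∀ u : W, 0 ≤ C u u := fun u => hE0 _ (Xi_mem_Vtilde hr S i u)
  have hker : ∀ v : W, v ≠ 0 → C v v = 0 → 0 < B v v := by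
    intro v hv h0
    have h1 := (hcoer v v.2 (hdofker v v.2 h0)).1
    have h2 : 0 < ∫ x in region (S i), v.1 x ^ 2 := by
      by_contra hcon
      exact hv (Subtype.ext (Vtilde_eq_zero_of_integral_sq v.2 (not_lt.1 hcon) (hS i)))
    have hh := h_pos (by omega) M
    exact lt_of_lt_of_le (by positivity) h1
  have hne : ∃ v w, C v w ≠ 0 := by
    by_contra hcon
    push Not at hcon
    exact hv₀k ⟨hv₀, fun w hw => hcon ⟨v₀, hv₀⟩ ⟨w, hw⟩⟩
  have hlow : ∀ p : W, -(3 * κ * M.Ceig S amax nmin Cinv) * C p p ≤ B p p := by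
    intro p
    -- The interpolant carries the unweighted nodal values of `p`, so that `p - w` vanishes at the
    -- interior nodes.
    set w₀ := M.nodalSum r (S i) p.1
    set w : W := ⟨(region (S i)).indicator w₀, w₀, nodalSum_mem_Vh hr _, rfl⟩
    set z : W := p - w
    have hz : ∀ l ∈ M.dof r (S i), z.1 l = 0 := fun l hl => by
      change p.1 l - (region (S i)).indicator w₀ l = 0
      rw [Set.indicator_of_mem (mem_region_of_mem_dof hr (hS i) hl),
        show w₀ l = p.1 l from nodalSum_apply_dof hr _ hl, sub_self]
    have h1 : e z z ≤ 2 * B z z := (hcoer z z.2 hz).2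
    have hp : p = w + z := by simp only [z]; abel
    have h2 : B p p = B w w + 2 * B w z + B z z := by
      rw [hp]
      simp only [map_add, LinearMap.add_apply]
      rw [hBs z w]; ring
    -- Young's inequality in the form `2 B(w, z) ≥ -2 e(w, w) - e(z, z) / 2`; the opposite signs in
    -- `h3` and `h4` match those of `a` and `m` in `B`. The last term is absorbed by `B z z`.
    have h3 := ha0 ((2 : ℝ) • w + z)
    have h4 := hm0 ((2 : ℝ) • w - z)
    simp only [map_add, map_smul, LinearMap.add_apply, LinearMap.smul_apply, smul_eq_mul,
      has z w] at h3
    simp only [map_sub, map_smul, LinearMap.sub_apply, LinearMap.smul_apply, smul_eq_mul,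
      hms z w] at h4
    have h5 : -3 * e w w ≤ B p p := by
      have h6 := mul_nonneg (sq_nonneg k) h4
      have h7 := ha0 w
      have h8 := mul_nonneg (sq_nonneg k) (hm0 w)
      rw [h2]
      simp only [hBa, hea] at h1 ⊢
      linarith
    set ξ := M.nodalSum r (S i) fun l => (M.mult r S l : ℝ)⁻¹ * p.1 l
    have hξ : ξ ∈ M.Vh r := nodalSum_mem_Vh hr _
    have h9 : ∑ T ∈ S i, ∫ x in hull T, w₀ x ^ 2 ≤ κ * (M.overlap S : ℝ) ^ 2 *
        ∫ x in region (S i), M.Xi r S i p x ^ 2 := by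
      rw [Xi_eq, integral_indicator_sq, M.setIntegral_region (hS i)
        (admissible_of_mem_Vh hξ (hS i)).integrable_sq, Finset.mul_sum]
      refine Finset.sum_le_sum fun T hT => hstab M (S i) _ _ _ (Nat.cast_nonneg _)
        (fun l hl => ?_) T (hS i hT)
      have h10 : (1 : ℝ) ≤ M.mult r S l := by exact_mod_cast one_le_mult hl
      have h11 : (M.mult r S l : ℝ) ≤ M.overlap S := by
        exact_mod_cast mult_le_overlap hr hS hl.1
      rw [abs_mul, abs_inv, Nat.abs_cast, ← mul_assoc, ← div_eq_mul_inv]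
      exact le_mul_of_one_le_left (abs_nonneg _) ((one_le_div (by linarith)).2 h11)
    have h12 : e w w ≤ (amax * Cinv ^ 2 + 1) * k ^ 2 * ∑ T ∈ S i, ∫ x in hull T, w₀ x ^ 2 :=
      inner1k_nodalSum_le hr (hS i) hcoR hinv p.1
    have h13 : k ^ 2 * nmin * ∫ x in region (S i), M.Xi r S i p x ^ 2 ≤ C p p :=
      hE _ (Xi_mem_Vtilde hr S i p)
    set J := ∫ x in region (S i), M.Xi r S i p x ^ 2
    set X := amax * Cinv ^ 2
    have hX : 0 ≤ X := mul_nonneg (zero_le_one.trans hco.one_le_amax) (sq_nonneg _)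
    -- The argument produces only the factor `X + 1`, which the square in `Ceig` dominates.
    have hX' : X + 1 ≤ (X + 2) ^ 2 := by nlinarith
    set Λ : ℝ := (M.overlap S : ℝ)
    have h14 : e w w ≤ κ * M.Ceig S amax nmin Cinv * C p p := by
      calc e w w ≤ (X + 1) * k ^ 2 * (κ * Λ ^ 2 * J) :=
            h12.trans (mul_le_mul_of_nonneg_left h9 (by positivity))
        _ = κ * (Λ ^ 2 * nmin⁻¹ * (X + 1)) * (k ^ 2 * nmin * J) := by field_simp
        _ ≤ κ * (Λ ^ 2 * nmin⁻¹ * (X + 1)) * C p p :=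
            mul_le_mul_of_nonneg_left h13 (by positivity)
        _ ≤ κ * (Λ ^ 2 * nmin⁻¹ * (X + 2) ^ 2) * C p p := by
            have := hC0 p
            gcongr
        _ = _ := rfl
    linarith
  obtain ⟨lam, hlam, hle⟩ := exists_isLeast_eigenvalue B C hBs hCs hC0 hker hne hlow
  refine ⟨lam, ?_, hle⟩
  convert hlam using 1
  ext t
  constructor
  · rintro ⟨p, hp, hp0, h⟩
    exact ⟨⟨p, hp⟩, fun h => hp0 (congrArg Subtype.val h), fun v => h v v.2⟩
  · rintro ⟨p, hp0, h⟩
    exact ⟨p, p.2, fun h => hp0 (Subtype.ext h), fun v hv => h ⟨v, hv⟩⟩
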